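/- Let $d\ge 1$ and let $\mathbb{N}_*=\{1,2,\dots\}$. Let $\mu$ be a probability measure on $\mathbb{N}_*^d$ that is aperiodic, i.e. the additive group generated by its support $\{k:\mu(\{k\})>0\}$ is all of $\mathbb{Z}^d$. Let $E=\operatorname{diag}(1/\alpha_1,\dots,1/\alpha_d)$ with $\alpha_1,\dots,\alpha_d>0$, and let $\nu$ be a probability measure on $\mathbb{R}_+^d=[0,\infty)^d$ that is full, i.e. not supported on any affine hyperplane of $\mathbb{R}^d$. Assume $\mu\in\mathcal{D}(E,\nu)$, i.e. $\mu$ is in the strict domain of normal attraction of $(E,\nu)$: if $\xi_1,\xi_2,\dots$ are i.i.d. with law $\mu$, then $$n^{-E}\sum_{i=1}^n \xi_i \Rightarrow \nu \qquad (n\to\infty)$$ in distribution, where $n^{-E}=\exp(-(\log n)E)$. (These assumptions force $\alpha_i\in(0,1)$ for all $i$.) Let $(Z_n)_{n\in\mathbb{Z}^d}$ be i.i.d. random variables with law $\mu$, and let $\mathcal{G}_\mu$ be the random directed graph with vertex set $\mathbb{Z}^d$ and one directed edge from $n$ to $n-Z_n$ for each $n\in\mathbb{Z}^d$; its components are the connected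 components obtained by ignoring the orientation of the edges. Then $\mathcal{G}_\mu$ has almost surely infinitely many components if and only if $$q(E):=\operatorname{trace}(E)=\sum_{i=1}^d \frac{1}{\alpha_i}>2.$$ -/

import Mathlib

open MeasureTheory ProbabilityTheory Filter

/-- The matrix power `r ^ A = exp ((log r) A)`, for `r > 0` and a real square matrix `A`. -/
noncomputable def matrixRPow {d : ℕ} (r : ℝ) (A : Matrix (Fin d) (Fin d) ℝ) :
    Matrix (Fin d) (Fin d) ℝ :=
  NormedSpace.exp (Real.log r • A)

/-- `μ` lives on the vectors of `ℤ^d` all of whose coordinates are at least `1`. -/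
def IsCarriedByPositive {d : ℕ} (μ : Measure (Fin d → ℤ)) : Prop :=
  ∀ᵐ k ∂μ, ∀ i, 1 ≤ k i

/-- The additive group generated by the support of `μ` is all of `ℤ^d`. -/
def IsAperiodic {d : ℕ} (μ : Measure (Fin d → ℤ)) : Prop :=
  AddSubgroup.closure {k : Fin d → ℤ | μ {k} ≠ 0} = ⊤

/-- `ν` is full: it is not carried by any affine hyperplane of `ℝ^d`. -/
def IsFullMeasure {d : ℕ} (ν : Measure (Fin d → ℝ)) : Prop :=
  ∀ (a : Fin d → ℝ) (c : ℝ), a ≠ 0 → ¬ ∀ᵐ x ∂ν, a ⬝ᵥ x = c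

/-- `μ` is in the strict domain of normal attraction of `(E, ν)`: for `ξ 0, ξ 1, …` i.i.d. with
law `μ` (realized as the coordinates of the infinite product of copies of `μ`), the normalized sums
`n ^ (-E) (ξ 0 + ⋯ + ξ (n - 1))` converge in distribution to `ν`. -/
def InStrictDomainOfNormalAttraction {d : ℕ} (E : Matrix (Fin d) (Fin d) ℝ)
    (ν : Measure (Fin d → ℝ)) [IsProbabilityMeasure ν]
    (μ : Measure (Fin d → ℤ)) [IsProbabilityMeasure μ] : Prop :=
  TendstoInDistribution
    (fun (n : ℕ) (ξ : ℕ → Fin d → ℤ) =>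
      (matrixRPow (n : ℝ) (-E)).mulVec (∑ i ∈ Finset.range n, fun j => (ξ i j : ℝ)))
    atTop (id : (Fin d → ℝ) → (Fin d → ℝ))
    (fun _ => Measure.infinitePi (fun _ : ℕ => μ)) ν

/-- The directed graph on `ℤ^d` whose edges go from `n` to `n - z n`, for every site `n`. -/
def ancestorDigraph {d : ℕ} (z : (Fin d → ℤ) → (Fin d → ℤ)) : Digraph (Fin d → ℤ) where
  Adj n m := m = n - z n

/-- The connected components of a directed graph, the orientation of the edges being ignored. -/
abbrev digraphComponent {V : Type*} (G : Digraph V) : Type _ :=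
  G.toSimpleGraphInclusive.ConnectedComponent

/-! Every site has one outgoing edge, so two sites are connected exactly when their ancestral lines
coalesce (`reachable_iff_linesMeet`). Since all coordinates of the steps are positive, a line never
revisits a site, and two lines read disjoint parts of the environment before they first meet. Up to
that moment they are therefore two independent walks (`infinitePi_firstMeet`). Coalescence is thus
at least as likely as a meeting of independent walks (`le_measure_linesMeet`) and at most as likely
as the expected number of their common positions (`measure_linesMeet_le`). For walks from one site
this expectation is `∑ G(v)²`, with `G` the renewal function (`tsum_twoStepSequences_eq`). Write `q
= ∑ 1 / α j`.

If `q ≤ 2`, tightness confines the first `n` positions, with probability at least 1/2, to a box of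
`O(n ^ q)`, hence `O(n²)`, points. So `G` has mass at least `n / 2` on that box, and Cauchy–Schwarz
excludes `∑ G² < ∞` (`tsum_twoStepSequences_eq_top`). Decomposing at the last common position turns
divergence into almost sure return (`measure_noReturn_eq_zero`), and aperiodicity extends this to
every initial displacement (`measure_compl_meetOften`). All lines coalesce and the graph is
connected.

If `q > 2`, fullness of `ν` and the scaling by `n ^ E` give `|φ(θ)| ≤ exp (-∑ b j |θ j| ^ α j)` near
0 for the characteristic function `φ` of `μ` (`exists_norm_stepChar_le`). A smoothing inequality
that only sees `φ` near 0 then bounds all point masses of the `n`-step law by `O(n ^ (-q))`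
(`exists_sumMass_le`). A common position at times `k, j` has probability `O(max(k, j) ^ (-q))`,
which is summable over pairs. By dominated convergence distant walks have few common positions in
expectation, and Borel–Cantelli along a sparse diagonal sequence of sites yields infinitely many
lines that never coalesce (`ae_infinite_digraphComponent`). -/

/-- The out-neighbour of `n` in the graph of the environment `z`. -/
def ancestor {d : ℕ} (z : (Fin d → ℤ) → (Fin d → ℤ)) (n : Fin d → ℤ) : Fin d → ℤ := n - z n

/-- The ancestral lines of `x` and `y` have a common site. -/
def LinesMeet {d : ℕ} (z : (Fin d → ℤ) → (Fin d → ℤ)) (x y : Fin d → ℤ) : Prop :=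
  ∃ k j : ℕ, (ancestor z)^[k] x = (ancestor z)^[j] y

/-- The walk from `x` with successive downward steps `a 0, a 1, …`. -/
def walk {d : ℕ} (x : Fin d → ℤ) (a : ℕ → Fin d → ℤ) (k : ℕ) : Fin d → ℤ :=
  x - ∑ i ∈ Finset.range k, a i

/-- The steps made along the ancestral line of `x`. -/
def lineSteps {d : ℕ} (z : (Fin d → ℤ) → (Fin d → ℤ)) (x : Fin d → ℤ) (i : ℕ) : Fin d → ℤ :=
  z ((ancestor z)^[i] x)

/-! ### Coalescence of lines and first meetings of monotone walks. -/

section Deterministic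

variable {d : ℕ} {z : (Fin d → ℤ) → (Fin d → ℤ)} {x y : Fin d → ℤ} {a a' b b' : ℕ → Fin d → ℤ}
  {k k' j j' : ℕ}

lemma linesMeet_equivalence (z : (Fin d → ℤ) → (Fin d → ℤ)) : Equivalence (LinesMeet z) where
  refl x := ⟨0, 0, rfl⟩
  symm := fun ⟨k, j, h⟩ => ⟨j, k, h.symm⟩
  trans := by
    rintro u v w ⟨k, j, h⟩ ⟨k', j', h'⟩
    refine ⟨k' + k, j + j', ?_⟩
    rw [Function.iterate_add_apply, h, ← Function.iterate_add_apply, add_comm k' j,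
      Function.iterate_add_apply, h', ← Function.iterate_add_apply]

lemma reachable_ancestor (z : (Fin d → ℤ) → (Fin d → ℤ)) (x : Fin d → ℤ) :
    (ancestorDigraph z).toSimpleGraphInclusive.Reachable x (ancestor z x) := by
  by_cases h : x = ancestor z x
  · rw [← h]
  · exact SimpleGraph.Adj.reachable ⟨h, Or.inl rfl⟩

lemma reachable_iterate_ancestor (z : (Fin d → ℤ) → (Fin d → ℤ)) (x : Fin d → ℤ) (k : ℕ) :
    (ancestorDigraph z).toSimpleGraphInclusive.Reachable x ((ancestor z)^[k] x) := by
  induction k with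
  | zero => exact SimpleGraph.Reachable.refl x
  | succ k ih =>
    rw [Function.iterate_succ_apply']
    exact ih.trans (reachable_ancestor z _)

/-- With out-degree one, each unoriented edge joins a site to its own ancestor, and coalescence is
an equivalence relation containing these pairs. -/
lemma reachable_iff_linesMeet :
    (ancestorDigraph z).toSimpleGraphInclusive.Reachable x y ↔ LinesMeet z x y := by
  constructor
  · rintro ⟨p⟩
    induction p with
    | nil => exact (linesMeet_equivalence z).refl _
    | cons h _ ih =>
      refine (linesMeet_equivalence z).trans ?_ ih
      rcases h.2 with h | h
      · exact ⟨1, 0, h.symm⟩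
      · exact ⟨0, 1, h⟩
  · rintro ⟨k, j, h⟩
    exact (reachable_iterate_ancestor z x k).trans
      (h ▸ (reachable_iterate_ancestor z y j).symm)

@[simp] lemma walk_zero : walk x a 0 = x := by simp [walk]

lemma walk_succ : walk x a (k + 1) = walk x a k - a k := by
  simp [walk, Finset.sum_range_succ, sub_sub]

lemma walk_congr (h : ∀ i < k, a i = a' i) (hj : j ≤ k) : walk x a j = walk x a' j := by
  unfold walk
  rw [Finset.sum_congr rfl fun i hi => h i ((Finset.mem_range.1 hi).trans_le hj)]

lemma iterate_ancestor_eq_walk : (ancestor z)^[k] x = walk x (lineSteps z x) k := by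
  induction k with
  | zero => simp
  | succ k ih => rw [Function.iterate_succ_apply', walk_succ, ← ih]; rfl

lemma linesMeet_iff_walk :
    LinesMeet z x y ↔ ∃ k j, walk x (lineSteps z x) k = walk y (lineSteps z y) j := by
  simp only [LinesMeet, iterate_ancestor_eq_walk]

/-- The right side fixes the environment at prescribed sites, so an event about a random path
becomes a cylinder event. -/
lemma lineSteps_eq_iff :
    (∀ i < k, lineSteps z x i = a i) ↔ ∀ i < k, z (walk x a i) = a i := by
  constructor
  · intro h i hi
    have := h i hi
    rwa [lineSteps, iterate_ancestor_eq_walk, walk_congr h hi.le] at this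
  · intro h
    have key : ∀ i ≤ k, (ancestor z)^[i] x = walk x a i := by
      intro i
      induction i with
      | zero => simp
      | succ i ih =>
        intro hi
        rw [Function.iterate_succ_apply', ih (by omega), walk_succ, ancestor, h i (by omega)]
    intro i hi
    rw [lineSteps, key i hi.le, h i hi]

lemma walk_lt (c : Fin d) (h : ∀ i < k, 1 ≤ a i c) {i : ℕ} (hi : i < k) :
    walk x a k c < walk x a i c := by
  induction k with
  | zero => omega
  | succ k ih =>
    have h1 := h k (by omega)
    have h2 : walk x a (k + 1) c = walk x a k c - a k c := by rw [walk_succ]; rfl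
    rcases Nat.lt_succ_iff_lt_or_eq.1 hi with h3 | rfl
    · have := ih (fun i hi => h i (by omega)) h3
      omega
    · omega

lemma walk_injOn (c : Fin d) (h : ∀ i < k, 1 ≤ a i c) :
    Set.InjOn (walk x a) (Finset.range k : Set ℕ) := by
  intro i hi l hl hil
  simp only [Finset.coe_range, Set.mem_Iio] at hi hl
  by_contra hne
  rcases lt_or_gt_of_ne hne with h1 | h1
  · have := walk_lt (x := x) c (k := l) (fun m hm => h m (by omega)) h1
    rw [hil] at this; omega
  · have := walk_lt (x := x) c (k := i) (fun m hm => h m (by omega)) h1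
    rw [hil] at this; omega

/-- The walks with steps `a`, `b` make positive steps in direction `c` up to the indices `k`, `j`,
where they have a common position, and they have no common position before. -/
def FirstMeet (c : Fin d) (x y : Fin d → ℤ) (k j : ℕ) (a b : ℕ → Fin d → ℤ) : Prop :=
  walk x a k = walk y b j ∧ (∀ i < k, ∀ l < j, walk x a i ≠ walk y b l) ∧
    (∀ i < k, 1 ≤ a i c) ∧ ∀ l < j, 1 ≤ b l c

lemma FirstMeet.congr {c : Fin d} (h : FirstMeet c x y k j a b) (ha : ∀ i < k, a i = a' i)
    (hb : ∀ l < j, b l = b' l) : FirstMeet c x y k j a' b' := by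
  obtain ⟨h1, h2, h3, h4⟩ := h
  refine ⟨?_, fun i hi l hl => ?_, fun i hi => ha i hi ▸ h3 i hi, fun l hl => hb l hl ▸ h4 l hl⟩
  · rwa [← walk_congr ha le_rfl, ← walk_congr hb le_rfl]
  · rw [← walk_congr ha hi.le, ← walk_congr hb hl.le]
    exact h2 i hi l hl

/-- Minimizing `k` alone suffices: an earlier position of the first walk then lies nowhere on the
second walk. -/
lemma exists_firstMeet {c : Fin d} (ha : ∀ i, 1 ≤ a i c) (hb : ∀ i, 1 ≤ b i c)
    (h : ∃ k j, walk x a k = walk y b j) : ∃ k j, FirstMeet c x y k j a b := by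
  classical
  obtain ⟨j, hj⟩ := Nat.find_spec h
  refine ⟨_, j, hj, fun i hi l _ hil => ?_, fun i _ => ha i, fun i _ => hb i⟩
  exact Nat.find_min h hi ⟨l, hil⟩

/-- Both walks strictly decrease in direction `c`, so common positions are passed in the same order
by both. Meeting times thus form a chain in `ℕ × ℕ`. -/
lemma walk_meet_lt {c : Fin d} (ha : ∀ i, 1 ≤ a i c) (hb : ∀ i, 1 ≤ b i c)
    (h : walk x a k = walk y b j) (h' : walk x a k' = walk y b j') (hk : k < k') : j < j' := by
  have h1 := walk_lt (x := x) c (fun i _ => ha i) hk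
  rw [h, h'] at h1
  by_contra hj
  rcases (not_lt.1 hj).eq_or_lt with rfl | hj
  · omega
  · have := walk_lt (x := y) c (fun i _ => hb i) hj
    omega

lemma walk_meet_eq {c : Fin d} (hb : ∀ i, 1 ≤ b i c)
    (h : walk x a k = walk y b j) (h' : walk x a k = walk y b j') : j = j' := by
  by_contra hne
  rcases lt_or_gt_of_ne hne with hj | hj
  all_goals
    have := walk_lt (x := y) c (fun i _ => hb i) hj
    rw [← h, ← h'] at this
    omega

lemma FirstMeet.unique {c : Fin d} (ha : ∀ i, 1 ≤ a i c) (hb : ∀ i, 1 ≤ b i c)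
    (h : FirstMeet c x y k j a b) (h' : FirstMeet c x y k' j' a b) : k = k' ∧ j = j' := by
  have hk : k = k' := by
    by_contra hne
    rcases lt_or_gt_of_ne hne with hk | hk
    · exact h'.2.1 k hk j (walk_meet_lt ha hb h.1 h'.1 hk) h.1
    · exact h.2.1 k' hk j' (walk_meet_lt ha hb h'.1 h.1 hk) h'.1
  subst hk
  exact ⟨rfl, walk_meet_eq hb h.1 h'.1⟩

end Deterministic

/-! ### Comparison of ancestral lines with independent walks. -/

section Paths

variable {d : ℕ} (μ : Measure (Fin d → ℤ)) [IsProbabilityMeasure μ]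

/-- Before the meeting the two paths visit pairwise distinct sites, so the prescribed steps are read
from distinct independent variables. -/
lemma infinitePi_env_path {c : Fin d} {x y : Fin d → ℤ} {k j : ℕ} {a b : ℕ → Fin d → ℤ}
    (h : FirstMeet c x y k j a b) :
    Measure.infinitePi (fun _ : Fin d → ℤ => μ)
      {z | (∀ i < k, lineSteps z x i = a i) ∧ ∀ l < j, lineSteps z y l = b l} =
      (∏ i ∈ Finset.range k, μ {a i}) * ∏ l ∈ Finset.range j, μ {b l} := by
  classical
  obtain ⟨-, hne, ha, hb⟩ := h
  have inja := walk_injOn (x := x) c ha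
  have injb := walk_injOn (x := y) c hb
  let s := (Finset.range k).image (walk x a)
  let t := (Finset.range j).image (walk y b)
  -- The constraint imposed at the site `v`. By distinctness of the visited sites at most one of its
  -- clauses is active there.
  let T : (Fin d → ℤ) → Set (Fin d → ℤ) := fun v =>
    {u | (∀ i < k, walk x a i = v → u = a i) ∧ ∀ l < j, walk y b l = v → u = b l}
  have hset : {z : (Fin d → ℤ) → (Fin d → ℤ) |
      (∀ i < k, lineSteps z x i = a i) ∧ ∀ l < j, lineSteps z y l = b l} =
      Set.pi (s ∪ t : Finset _) T := by
    ext z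
    simp only [lineSteps_eq_iff, Set.mem_ofPred_eq, Set.mem_pi, T, Finset.coe_union,
      Set.mem_union, Finset.mem_coe, s, t, Finset.mem_image, Finset.mem_range]
    constructor
    · rintro ⟨h1, h2⟩ v -
      exact ⟨fun i hi hv => hv ▸ h1 i hi, fun l hl hv => hv ▸ h2 l hl⟩
    · intro h
      exact ⟨fun i hi => (h _ (Or.inl ⟨i, hi, rfl⟩)).1 i hi rfl,
        fun l hl => (h _ (Or.inr ⟨l, hl, rfl⟩)).2 l hl rfl⟩
  have hdisj : Disjoint s t := by
    rw [Finset.disjoint_left]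
    simp only [s, t, Finset.mem_image, Finset.mem_range]
    rintro v ⟨i, hi, rfl⟩ ⟨l, hl, hil⟩
    exact hne i hi l hl hil.symm
  have hTa : ∀ i ∈ Finset.range k, μ (T (walk x a i)) = μ {a i} := by
    intro i hi
    congr 1
    ext u
    simp only [T, Set.mem_ofPred_eq, Set.mem_singleton_iff]
    constructor
    · exact fun h => h.1 i (Finset.mem_range.1 hi) rfl
    · rintro rfl
      refine ⟨fun i' hi' h => ?_, fun l hl h =>
        absurd h.symm (hne i (Finset.mem_range.1 hi) l hl)⟩
      rw [inja (Finset.mem_coe.2 (Finset.mem_range.2 hi')) (Finset.mem_coe.2 hi) h]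
  have hTb : ∀ i ∈ Finset.range j, μ (T (walk y b i)) = μ {b i} := by
    intro i hi
    congr 1
    ext u
    simp only [T, Set.mem_ofPred_eq, Set.mem_singleton_iff]
    constructor
    · exact fun h => h.2 i (Finset.mem_range.1 hi) rfl
    · rintro rfl
      refine ⟨fun l hl h => absurd h (hne l hl i (Finset.mem_range.1 hi)), fun i' hi' h => ?_⟩
      rw [injb (Finset.mem_coe.2 (Finset.mem_range.2 hi')) (Finset.mem_coe.2 hi) h]
  rw [hset, Measure.infinitePi_pi _ (fun v _ => MeasurableSet.of_discrete),
    Finset.prod_union hdisj, Finset.prod_image inja, Finset.prod_image injb,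
    Finset.prod_congr rfl hTa, Finset.prod_congr rfl hTb]

lemma infinitePi_walk_path (k : ℕ) (a : ℕ → Fin d → ℤ) :
    Measure.infinitePi (fun _ : ℕ => μ) {a' | ∀ i < k, a' i = a i} =
      ∏ i ∈ Finset.range k, μ {a i} := by
  have : {a' : ℕ → Fin d → ℤ | ∀ i < k, a' i = a i} =
      Set.pi (Finset.range k : Finset ℕ) (fun i => {a i}) := by
    ext; simp
  rw [this, Measure.infinitePi_pi _ (fun v _ => MeasurableSet.of_discrete)]

/-- The law of two independent sequences of independent steps with law `μ`. -/
noncomputable abbrev twoStepSequences : Measure ((ℕ → Fin d → ℤ) × (ℕ → Fin d → ℤ)) :=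
  (Measure.infinitePi (fun _ : ℕ => μ)).prod (Measure.infinitePi (fun _ : ℕ => μ))

lemma twoStepSequences_path (k j : ℕ) (a b : ℕ → Fin d → ℤ) :
    twoStepSequences μ {p | (∀ i < k, p.1 i = a i) ∧ ∀ l < j, p.2 l = b l} =
      (∏ i ∈ Finset.range k, μ {a i}) * ∏ l ∈ Finset.range j, μ {b l} := by
  rw [← infinitePi_walk_path, ← infinitePi_walk_path, ← Measure.prod_prod]
  rfl

/-- The first `k` and `j` terms of two sequences. -/
def truncPair (k j : ℕ) (p : (ℕ → Fin d → ℤ) × (ℕ → Fin d → ℤ)) :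
    (Fin k → Fin d → ℤ) × (Fin j → Fin d → ℤ) :=
  (fun i => p.1 i, fun l => p.2 l)

lemma measurable_truncPair (k j : ℕ) : Measurable (truncPair (d := d) k j) := by
  unfold truncPair; fun_prop

lemma measurable_ancestor_iterate (x : Fin d → ℤ) (k : ℕ) :
    Measurable fun z : (Fin d → ℤ) → (Fin d → ℤ) => (ancestor z)^[k] x := by
  induction k with
  | zero => exact measurable_const
  | succ k ih =>
    have : ∀ z : (Fin d → ℤ) → (Fin d → ℤ),
        (ancestor z)^[k + 1] x = (ancestor z)^[k] x - z ((ancestor z)^[k] x) := by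
      intro z; rw [Function.iterate_succ_apply']; rfl
    simp only [this]
    refine ih.sub ?_
    have h2 : Measurable fun p : (Fin d → ℤ) × ((Fin d → ℤ) → (Fin d → ℤ)) => p.2 p.1 :=
      measurable_from_prod_countable_right fun v => measurable_pi_apply v
    exact h2.comp (ih.prodMk measurable_id)

lemma measurable_lineSteps (x : Fin d → ℤ) :
    Measurable fun z : (Fin d → ℤ) → (Fin d → ℤ) => lineSteps z x := by
  refine measurable_pi_iff.2 fun k => ?_
  have h2 : Measurable fun p : (Fin d → ℤ) × ((Fin d → ℤ) → (Fin d → ℤ)) => p.2 p.1 :=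
    measurable_from_prod_countable_right fun v => measurable_pi_apply v
  exact h2.comp ((measurable_ancestor_iterate x k).prodMk measurable_id)

/-- Two ancestral lines have the same law as two independent walks until they meet. -/
lemma infinitePi_firstMeet (c : Fin d) (x y : Fin d → ℤ) (k j : ℕ) :
    Measure.infinitePi (fun _ : Fin d → ℤ => μ)
      {z | FirstMeet c x y k j (lineSteps z x) (lineSteps z y)} =
      twoStepSequences μ {p | FirstMeet c x y k j p.1 p.2} := by
  classical
  -- Padding by 0 is harmless: `FirstMeet` only depends on the first `k` and `j` steps.
  let ext : (m : ℕ) → (Fin m → Fin d → ℤ) → ℕ → Fin d → ℤ :=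
    fun m a i => if h : i < m then a ⟨i, h⟩ else 0
  let D : Set ((Fin k → Fin d → ℤ) × (Fin j → Fin d → ℤ)) :=
    {q | FirstMeet c x y k j (ext k q.1) (ext j q.2)}
  have hD : ∀ p, FirstMeet c x y k j p.1 p.2 ↔ truncPair k j p ∈ D := by
    intro p
    have e1 : ∀ i < k, p.1 i = ext k (truncPair k j p).1 i := by
      intro i hi; simp [ext, hi, truncPair]
    have e2 : ∀ i < j, p.2 i = ext j (truncPair k j p).2 i := by
      intro i hi; simp [ext, hi, truncPair]
    exact ⟨fun h => h.congr e1 e2,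
      fun h => h.congr (fun i hi => (e1 i hi).symm) (fun i hi => (e2 i hi).symm)⟩
  have hT : ∀ p q, truncPair k j p = q ↔
      (∀ i < k, p.1 i = ext k q.1 i) ∧ ∀ l < j, p.2 l = ext j q.2 l := by
    intro p q
    constructor
    · rintro rfl
      exact ⟨fun i hi => by simp [ext, hi, truncPair], fun i hi => by simp [ext, hi, truncPair]⟩
    · rintro ⟨h1, h2⟩
      refine Prod.ext (funext fun i => ?_) (funext fun i => ?_)
      · simpa [ext, truncPair] using h1 i i.2
      · simpa [ext, truncPair] using h2 i i.2
  let L : ((Fin d → ℤ) → (Fin d → ℤ)) → (ℕ → Fin d → ℤ) × (ℕ → Fin d → ℤ) :=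
    fun z => (lineSteps z x, lineSteps z y)
  have hL : Measurable L := (measurable_lineSteps x).prodMk (measurable_lineSteps y)
  have hm := measurable_truncPair (d := d) k j
  -- The truncated pairs form a countable space, so equality of the two laws at each point of `D` is
  -- enough.
  have key : ∀ q ∈ D,
      Measure.map (truncPair k j ∘ L) (Measure.infinitePi (fun _ : Fin d → ℤ => μ)) {q} =
      Measure.map (truncPair k j) (twoStepSequences μ) {q} := by
    intro q hq
    rw [Measure.map_apply (hm.comp hL) (measurableSet_singleton q),
      Measure.map_apply hm (measurableSet_singleton q)]
    have h1 : truncPair k j ∘ L ⁻¹' {q} = {z | (∀ i < k, lineSteps z x i = ext k q.1 i) ∧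
        ∀ l < j, lineSteps z y l = ext j q.2 l} := by
      ext z; exact hT (L z) q
    have h2 : truncPair k j ⁻¹' {q} = {p | (∀ i < k, p.1 i = ext k q.1 i) ∧
        ∀ l < j, p.2 l = ext j q.2 l} := by
      ext z; exact hT z q
    rw [h1, h2, infinitePi_env_path μ hq, twoStepSequences_path]
  have e1 : {z | FirstMeet c x y k j (lineSteps z x) (lineSteps z y)} =
      truncPair k j ∘ L ⁻¹' D := by
    ext z; exact hD (L z)
  have e2 : {p : (ℕ → Fin d → ℤ) × (ℕ → Fin d → ℤ) | FirstMeet c x y k j p.1 p.2} =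
      truncPair k j ⁻¹' D := by
    ext z; exact hD z
  rw [e1, e2, ← Measure.map_apply (hm.comp hL) MeasurableSet.of_discrete,
    ← Measure.map_apply hm MeasurableSet.of_discrete, ← Set.biUnion_of_singleton D,
    measure_biUnion D.to_countable (fun q _ q' _ h => by simpa using h)
      (fun _ _ => measurableSet_singleton _),
    measure_biUnion D.to_countable (fun q _ q' _ h => by simpa using h)
      (fun _ _ => measurableSet_singleton _)]
  exact tsum_congr fun q => key q q.2

end Paths

/-! ### Upper and lower bounds for the probability of coalescence. -/

section Meeting

variable {d : ℕ} {μ : Measure (Fin d → ℤ)} [IsProbabilityMeasure μ]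

lemma ae_infinitePi_pos {ι : Type*} [Countable ι] (hμ : IsCarriedByPositive μ) :
    ∀ᵐ z ∂Measure.infinitePi (fun _ : ι => μ), ∀ n c, 1 ≤ z n c := by
  rw [ae_all_iff]
  intro n
  exact (measurePreserving_eval_infinitePi (fun _ : ι => μ) n).quasiMeasurePreserving.ae hμ

lemma ae_twoStepSequences_pos (hμ : IsCarriedByPositive μ) :
    ∀ᵐ p ∂twoStepSequences μ, (∀ n c, 1 ≤ p.1 n c) ∧ ∀ n c, 1 ≤ p.2 n c := by
  have h := ae_infinitePi_pos (ι := ℕ) hμ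
  filter_upwards [Measure.quasiMeasurePreserving_fst.ae h,
    Measure.quasiMeasurePreserving_snd.ae h] with p h1 h2 using ⟨h1, h2⟩

lemma measurable_walk (x : Fin d → ℤ) (k : ℕ) : Measurable fun a => walk x a k := by
  unfold walk
  fun_prop

lemma measurableSet_walk_eq (x y : Fin d → ℤ) (k j : ℕ) :
    MeasurableSet {p : (ℕ → Fin d → ℤ) × (ℕ → Fin d → ℤ) | walk x p.1 k = walk y p.2 j} :=
  measurableSet_eq_fun ((measurable_walk x k).comp measurable_fst)
    ((measurable_walk y j).comp measurable_snd)

lemma measurableSet_firstMeet (c : Fin d) (x y : Fin d → ℤ) (k j : ℕ) :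
    MeasurableSet {p : (ℕ → Fin d → ℤ) × (ℕ → Fin d → ℤ) | FirstMeet c x y k j p.1 p.2} := by
  have h : ∀ k j, Measurable fun p : (ℕ → Fin d → ℤ) × (ℕ → Fin d → ℤ) =>
      walk x p.1 k = walk y p.2 j := fun k j => measurableSet_setOfPred.1 (measurableSet_walk_eq x y k j)
  have h1 : ∀ i, Measurable fun p : (ℕ → Fin d → ℤ) × (ℕ → Fin d → ℤ) => 1 ≤ p.1 i c := fun i =>
    measurableSet_setOfPred.1 (measurableSet_le measurable_const (by fun_prop))
  have h2 : ∀ i, Measurable fun p : (ℕ → Fin d → ℤ) × (ℕ → Fin d → ℤ) => 1 ≤ p.2 i c := fun i =>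
    measurableSet_setOfPred.1 (measurableSet_le measurable_const (by fun_prop))
  refine measurableSet_setOfPred.2 ((h k j).and (Measurable.and ?_ (Measurable.and ?_ ?_)))
  · exact .forall fun i => .forall fun _ => .forall fun l => .forall fun _ => (h i l).not
  · exact .forall fun i => .forall fun _ => h1 i
  · exact .forall fun i => .forall fun _ => h2 i

/-- Union bound for the meeting of two ancestral lines. -/
lemma measure_linesMeet_le (hd : 1 ≤ d) (hμ : IsCarriedByPositive μ) (x y : Fin d → ℤ) :
    Measure.infinitePi (fun _ : Fin d → ℤ => μ) {z | LinesMeet z x y} ≤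
      ∑' q : ℕ × ℕ, twoStepSequences μ {p | walk x p.1 q.1 = walk y p.2 q.2} := by
  let c : Fin d := ⟨0, hd⟩
  calc Measure.infinitePi (fun _ : Fin d → ℤ => μ) {z | LinesMeet z x y}
      ≤ Measure.infinitePi (fun _ : Fin d → ℤ => μ)
        (⋃ q : ℕ × ℕ, {z | FirstMeet c x y q.1 q.2 (lineSteps z x) (lineSteps z y)}) := by
        refine measure_mono_ae ?_
        filter_upwards [ae_infinitePi_pos (ι := Fin d → ℤ) hμ] with z hz h
        obtain ⟨k, j, hkj⟩ := exists_firstMeet (c := c) (fun i => hz _ _) (fun i => hz _ _)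
          (linesMeet_iff_walk.1 h)
        exact Set.mem_iUnion.2 ⟨(k, j), hkj⟩
    _ ≤ ∑' q : ℕ × ℕ, Measure.infinitePi (fun _ : Fin d → ℤ => μ)
        {z | FirstMeet c x y q.1 q.2 (lineSteps z x) (lineSteps z y)} := measure_iUnion_le _
    _ = ∑' q : ℕ × ℕ, twoStepSequences μ {p | FirstMeet c x y q.1 q.2 p.1 p.2} :=
        tsum_congr fun q => infinitePi_firstMeet μ c x y q.1 q.2
    _ ≤ _ := ENNReal.tsum_le_tsum fun q => measure_mono fun p hp => hp.1

/-- Two ancestral lines meet at least as likely as two independent walks. -/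
lemma le_measure_linesMeet (hd : 1 ≤ d) (hμ : IsCarriedByPositive μ) (x y : Fin d → ℤ) :
    twoStepSequences μ {p | ∃ k j, walk x p.1 k = walk y p.2 j} ≤
      Measure.infinitePi (fun _ : Fin d → ℤ => μ) {z | LinesMeet z x y} := by
  let c : Fin d := ⟨0, hd⟩
  have hL : Measurable fun z : (Fin d → ℤ) → (Fin d → ℤ) => (lineSteps z x, lineSteps z y) :=
    (measurable_lineSteps x).prodMk (measurable_lineSteps y)
  let F : ℕ × ℕ → Set ((Fin d → ℤ) → (Fin d → ℤ)) := fun q =>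
    {z | FirstMeet c x y q.1 q.2 (lineSteps z x) (lineSteps z y)}
  have hnull : ∀ q, NullMeasurableSet (F q) (Measure.infinitePi (fun _ : Fin d → ℤ => μ)) :=
    fun q => (hL (measurableSet_firstMeet c x y q.1 q.2)).nullMeasurableSet
  -- First meeting times are unique only when all steps are positive, hence disjointness up to a
  -- null set.
  have hdisj : Pairwise fun q q' =>
      AEDisjoint (Measure.infinitePi (fun _ : Fin d → ℤ => μ)) (F q) (F q') := by
    intro q q' hq
    refine measure_mono_null (t := {z | ¬ ∀ n c, 1 ≤ z n c}) ?_
      (ae_infinitePi_pos (ι := Fin d → ℤ) hμ)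
    intro z hz hpos
    have h1 : FirstMeet c x y q.1 q.2 (lineSteps z x) (lineSteps z y) := hz.1
    have h2 : FirstMeet c x y q'.1 q'.2 (lineSteps z x) (lineSteps z y) := hz.2
    exact hq (Prod.ext_iff.2 (h1.unique (fun i => hpos _ _) (fun i => hpos _ _) h2))
  calc twoStepSequences μ {p | ∃ k j, walk x p.1 k = walk y p.2 j}
      ≤ twoStepSequences μ (⋃ q : ℕ × ℕ, {p | FirstMeet c x y q.1 q.2 p.1 p.2}) := by
        refine measure_mono_ae ?_
        filter_upwards [ae_twoStepSequences_pos hμ] with p hp h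
        obtain ⟨k, j, hkj⟩ := exists_firstMeet (c := c) (fun i => hp.1 _ _) (fun i => hp.2 _ _) h
        exact Set.mem_iUnion.2 ⟨(k, j), hkj⟩
    _ ≤ ∑' q : ℕ × ℕ, twoStepSequences μ {p | FirstMeet c x y q.1 q.2 p.1 p.2} :=
        measure_iUnion_le _
    _ = ∑' q : ℕ × ℕ, Measure.infinitePi (fun _ : Fin d → ℤ => μ) (F q) :=
        tsum_congr fun q => (infinitePi_firstMeet μ c x y q.1 q.2).symm
    _ = Measure.infinitePi (fun _ : Fin d → ℤ => μ) (⋃ q : ℕ × ℕ, F q) := by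
        exact (measure_iUnion₀ hdisj hnull).symm
    _ ≤ _ := by
        refine measure_mono fun z hz => ?_
        obtain ⟨q, hq⟩ := Set.mem_iUnion.1 hz
        exact linesMeet_iff_walk.2 ⟨q.1, q.2, hq.1⟩

end Meeting

/-! ### Splitting off the first term of an i.i.d. sequence. -/

section Shift

variable {X : Type*} [MeasurableSpace X] (μ : Measure X) [IsProbabilityMeasure μ]

/-- The first term of an independent sequence is independent of the others. -/
lemma map_cons_infinitePi :
    Measure.map (fun p : X × (ℕ → X) => fun n : ℕ => Nat.casesOn (motive := fun _ => X) n p.1 p.2)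
      (μ.prod (Measure.infinitePi (fun _ : ℕ => μ))) = Measure.infinitePi (fun _ : ℕ => μ) := by
  classical
  have hmeas : Measurable fun p : X × (ℕ → X) =>
      fun n : ℕ => Nat.casesOn (motive := fun _ => X) n p.1 p.2 := by
    refine measurable_pi_iff.2 fun n => ?_
    cases n with
    | zero => exact measurable_fst
    | succ n => exact (measurable_pi_apply n).comp measurable_snd
  refine Measure.eq_infinitePi _ fun s t ht => ?_
  obtain ⟨N, hN⟩ : ∃ N, s ⊆ Finset.range (N + 1) :=
    ⟨s.sup id, fun i hi => Finset.mem_range.2 (Nat.lt_succ_of_le (Finset.le_sup (f := id) hi))⟩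
  let t' : ℕ → Set X := fun i => if i ∈ s then t i else Set.univ
  have ht' : ∀ i, MeasurableSet (t' i) := by
    intro i; simp only [t']; split_ifs; exacts [ht i, .univ]
  rw [Measure.map_apply hmeas (MeasurableSet.pi s.countable_toSet fun i _ => ht i)]
  have hpre : (fun p : X × (ℕ → X) =>
      fun n : ℕ => Nat.casesOn (motive := fun _ => X) n p.1 p.2) ⁻¹' (Set.pi s t) =
      t' 0 ×ˢ Set.pi (Finset.range N : Finset ℕ) (fun i => t' (i + 1)) := by
    ext p
    simp only [Set.mem_preimage, Set.mem_pi, Finset.mem_coe, Set.mem_prod, t', Finset.mem_range]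
    constructor
    · intro h
      refine ⟨?_, fun i hi => ?_⟩
      · split_ifs with h0
        exacts [h 0 h0, trivial]
      · split_ifs with h0
        exacts [h (i + 1) h0, trivial]
    · rintro ⟨h0, h1⟩ i hi
      cases i with
      | zero => simpa [hi] using h0
      | succ i =>
        have := h1 i (by have := Finset.mem_range.1 (hN hi); omega)
        simpa [hi] using this
  rw [hpre, Measure.prod_prod, Measure.infinitePi_pi _ (fun i _ => ht' _)]
  have : ∏ i ∈ s, μ (t i) = ∏ i ∈ Finset.range (N + 1), μ (t' i) := by
    rw [← Finset.prod_subset hN]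
    · exact Finset.prod_congr rfl fun i hi => by simp [t', hi]
    · intro i _ hi; simp [t', hi]
  rw [this, Finset.prod_range_succ']
  exact mul_comm _ _

/-- The sequence without its first `k` terms. -/
def seqShift {X : Type*} (k : ℕ) (a : ℕ → X) (n : ℕ) : X := a (n + k)

lemma measurable_seqShift (k : ℕ) : Measurable (seqShift (X := X) k) := by
  unfold seqShift; fun_prop

lemma infinitePi_head_tail {s : Set X} (hs : MeasurableSet s) {A : Set (ℕ → X)}
    (hA : MeasurableSet A) :
    Measure.infinitePi (fun _ : ℕ => μ) {a | a 0 ∈ s ∧ seqShift 1 a ∈ A} =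
      μ s * Measure.infinitePi (fun _ : ℕ => μ) A := by
  have hmeas : Measurable fun p : X × (ℕ → X) =>
      fun n : ℕ => Nat.casesOn (motive := fun _ => X) n p.1 p.2 := by
    refine measurable_pi_iff.2 fun n => ?_
    cases n with
    | zero => exact measurable_fst
    | succ n => exact (measurable_pi_apply n).comp measurable_snd
  have hm : MeasurableSet {a : ℕ → X | a 0 ∈ s ∧ seqShift 1 a ∈ A} :=
    (measurable_pi_apply 0 hs).inter (measurable_seqShift 1 hA)
  rw [← Measure.prod_prod]
  nth_rewrite 1 [← map_cons_infinitePi μ]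
  rw [Measure.map_apply hmeas hm]
  rfl

end Shift

/-! ### From infinite expectation to almost sure meeting. -/

section Recurrence

variable {d : ℕ} (μ : Measure (Fin d → ℤ)) [IsProbabilityMeasure μ]

/-- The sum of the first `k` steps. -/
def stepSum (k : ℕ) (a : ℕ → Fin d → ℤ) : Fin d → ℤ := ∑ i ∈ Finset.range k, a i

/-- The mass that the law of the sum of `k` independent steps gives to `v`. -/
noncomputable def sumMass (k : ℕ) (v : Fin d → ℤ) : ENNReal :=
  Measure.infinitePi (fun _ : ℕ => μ) {a | stepSum k a = v}

lemma measurable_stepSum (k : ℕ) : Measurable (stepSum (d := d) k) := by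
  unfold stepSum; fun_prop

lemma measurableSet_stepSum_eq (k : ℕ) (v : Fin d → ℤ) : MeasurableSet {a | stepSum k a = v} :=
  measurable_stepSum k (measurableSet_singleton v)

lemma stepSum_add (k m : ℕ) (a : ℕ → Fin d → ℤ) :
    stepSum (k + m) a = stepSum k a + stepSum m (seqShift k a) := by
  simp only [stepSum, Finset.sum_range_add, seqShift, add_comm]

@[simp] lemma stepSum_zero (a : ℕ → Fin d → ℤ) : stepSum 0 a = 0 := by simp [stepSum]

@[simp] lemma stepSum_one (a : ℕ → Fin d → ℤ) : stepSum 1 a = a 0 := by simp [stepSum]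

lemma stepSum_pos {a : ℕ → Fin d → ℤ} {c : Fin d} (ha : ∀ i, 1 ≤ a i c) {k : ℕ} (hk : k ≠ 0) :
    0 < stepSum k a c := by
  have := walk_lt (x := 0) (k := k) c (fun i _ => ha i) (Nat.pos_of_ne_zero hk)
  rw [walk_zero] at this
  simpa [walk, stepSum] using this

lemma seqShift_zero {X : Type*} (a : ℕ → X) : seqShift 0 a = a := rfl

lemma seqShift_seqShift {X : Type*} (k m : ℕ) (a : ℕ → X) :
    seqShift k (seqShift m a) = seqShift (k + m) a := by
  funext n; simp [seqShift, add_assoc]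

lemma infinitePi_stepSum_succ (k : ℕ) (v : Fin d → ℤ) {A : Set (ℕ → Fin d → ℤ)}
    (hA : MeasurableSet A) :
    Measure.infinitePi (fun _ : ℕ => μ) {a | stepSum (k + 1) a = v ∧ seqShift (k + 1) a ∈ A} =
      ∑' c, μ {c} * Measure.infinitePi (fun _ : ℕ => μ)
        {a | stepSum k a = v - c ∧ seqShift k a ∈ A} := by
  have hm : ∀ c, MeasurableSet {a | stepSum k a = v - c ∧ seqShift k a ∈ A} := fun c =>
    (measurableSet_stepSum_eq k _).inter (measurable_seqShift k hA)
  have hset : {a | stepSum (k + 1) a = v ∧ seqShift (k + 1) a ∈ A} =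
      ⋃ c, {a | a 0 ∈ ({c} : Set (Fin d → ℤ)) ∧
        seqShift 1 a ∈ {a | stepSum k a = v - c ∧ seqShift k a ∈ A}} := by
    ext a
    simp only [Set.mem_ofPred_eq, Set.mem_iUnion, Set.mem_singleton_iff, exists_eq_left',
      add_comm k 1, stepSum_add, stepSum_one, seqShift_seqShift]
    rw [eq_sub_iff_add_eq']
  rw [hset, measure_iUnion]
  · exact tsum_congr fun c => infinitePi_head_tail μ (measurableSet_singleton c) (hm c)
  · intro c c' hc
    rw [Function.onFun, Set.disjoint_left]
    rintro a ⟨h1, -⟩ ⟨h2, -⟩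
    exact hc (h1.symm.trans h2)
  · exact fun c => (measurable_pi_apply 0 (measurableSet_singleton c)).inter
      (measurable_seqShift 1 (hm c))

/-- Markov property at time `k`, by induction: conditioning on the first step gives the same
recursion for both sides. -/
lemma infinitePi_stepSum_seqShift (k : ℕ) (v : Fin d → ℤ) {A : Set (ℕ → Fin d → ℤ)}
    (hA : MeasurableSet A) :
    Measure.infinitePi (fun _ : ℕ => μ) {a | stepSum k a = v ∧ seqShift k a ∈ A} =
      sumMass μ k v * Measure.infinitePi (fun _ : ℕ => μ) A := by
  induction k generalizing v with
  | zero =>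
    by_cases hv : (0 : Fin d → ℤ) = v
    · simp [sumMass, hv, seqShift_zero]
    · simp [sumMass, hv]
  | succ k ih =>
    have h := infinitePi_stepSum_succ μ k v (MeasurableSet.univ)
    simp only [Set.mem_univ, and_true] at h
    rw [infinitePi_stepSum_succ μ k v hA, sumMass, h, ← ENNReal.tsum_mul_right]
    refine tsum_congr fun c => ?_
    rw [ih, mul_assoc]
    rfl

/-- The Markov property as an identity of measures, a form that passes to the product of two walks.
-/
lemma map_seqShift_restrict (k : ℕ) (v : Fin d → ℤ) :
    ((Measure.infinitePi (fun _ : ℕ => μ)).restrict {a | stepSum k a = v}).map (seqShift k) =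
      sumMass μ k v • Measure.infinitePi (fun _ : ℕ => μ) := by
  ext A hA
  rw [Measure.map_apply (measurable_seqShift k) hA,
    Measure.restrict_apply (measurable_seqShift k hA), Measure.smul_apply, smul_eq_mul,
    ← infinitePi_stepSum_seqShift μ k v hA]
  congr 1
  ext a
  exact and_comm

lemma sumMass_ne_top (k : ℕ) (v : Fin d → ℤ) : sumMass μ k v ≠ ⊤ := measure_ne_top _ _

/-- Simple Markov property of two independent walks. -/
lemma twoStepSequences_stepSum_seqShift (k j : ℕ) (v w : Fin d → ℤ)
    {A : Set ((ℕ → Fin d → ℤ) × (ℕ → Fin d → ℤ))} (hA : MeasurableSet A) :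
    twoStepSequences μ {p | (stepSum k p.1 = v ∧ stepSum j p.2 = w) ∧
      (seqShift k p.1, seqShift j p.2) ∈ A} =
      sumMass μ k v * sumMass μ j w * twoStepSequences μ A := by
  have hm : Measurable (Prod.map (seqShift (X := Fin d → ℤ) k) (seqShift (X := Fin d → ℤ) j)) :=
    (measurable_seqShift k).prodMap (measurable_seqShift j)
  have h1 : Measure.map (Prod.map (seqShift k) (seqShift j))
      ((twoStepSequences μ).restrict ({a | stepSum k a = v} ×ˢ {a | stepSum j a = w})) =
      (sumMass μ k v * sumMass μ j w) • twoStepSequences μ := by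
    rw [← Measure.prod_restrict, ← Measure.map_prod_map _ _ (measurable_seqShift k)
      (measurable_seqShift j), map_seqShift_restrict, map_seqShift_restrict]
    have : SFinite (sumMass μ j w • Measure.infinitePi (fun _ : ℕ => μ)) := by
      infer_instance
    rw [Measure.prod_smul_left, Measure.prod_smul_right, smul_smul]
  have h2 := congrArg (fun m => m A) h1
  simp only [Measure.smul_apply, smul_eq_mul] at h2
  rw [← h2, Measure.map_apply hm hA, Measure.restrict_apply (hm hA)]
  congr 1
  ext p
  exact and_comm

lemma sumMass_zero : sumMass μ 0 (0 : Fin d → ℤ) = 1 := by simp [sumMass]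

lemma sumMass_one (c : Fin d → ℤ) : sumMass μ 1 c = μ {c} := by
  have := infinitePi_head_tail μ (measurableSet_singleton c) MeasurableSet.univ
  simpa [sumMass] using this

/-- The probability that two independent walks have the same displacement at given times. -/
lemma twoStepSequences_sub_eq (k j : ℕ) (w : Fin d → ℤ) :
    twoStepSequences μ {p | stepSum k p.1 - stepSum j p.2 = w} =
      ∑' v, sumMass μ k (v + w) * sumMass μ j v := by
  have hset : {p : (ℕ → Fin d → ℤ) × (ℕ → Fin d → ℤ) | stepSum k p.1 - stepSum j p.2 = w} =
      ⋃ v, {a | stepSum k a = v + w} ×ˢ {b | stepSum j b = v} := by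
    ext p
    simp only [Set.mem_ofPred_eq, Set.mem_iUnion, Set.mem_prod]
    constructor
    · intro h
      exact ⟨_, by rw [← h]; abel, rfl⟩
    · rintro ⟨v, h1, h2⟩
      rw [h1, h2]; abel
  rw [hset, measure_iUnion]
  · exact tsum_congr fun v => Measure.prod_prod _ _
  · intro v v' hv
    rw [Function.onFun, Set.disjoint_left]
    rintro p ⟨-, h1⟩ ⟨-, h2⟩
    exact hv (h1.symm.trans h2)
  · exact fun v => (measurableSet_stepSum_eq k _).prod (measurableSet_stepSum_eq j _)

lemma measurableSet_sub_eq (k j : ℕ) (w : Fin d → ℤ) : MeasurableSet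
    {p : (ℕ → Fin d → ℤ) × (ℕ → Fin d → ℤ) | stepSum k p.1 - stepSum j p.2 = w} :=
  (((measurable_stepSum k).comp measurable_fst).sub
    ((measurable_stepSum j).comp measurable_snd)) (measurableSet_singleton w)

/-- Two walks have no common position after the start. -/
def noReturn (d : ℕ) : Set ((ℕ → Fin d → ℤ) × (ℕ → Fin d → ℤ)) :=
  {p | ∀ k j, (k, j) ≠ (0, 0) → stepSum k p.1 - stepSum j p.2 ≠ 0}

lemma measurableSet_noReturn : MeasurableSet (noReturn d) := by
  have : noReturn d = ⋂ q : ℕ × ℕ, ⋂ _ : q ≠ (0, 0),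
      {p | stepSum q.1 p.1 - stepSum q.2 p.2 = 0}ᶜ := by
    ext p
    simp only [noReturn, Set.mem_ofPred_eq, Set.mem_iInter, Set.mem_compl_iff, Prod.forall]
  rw [this]
  exact .iInter fun q => .iInter fun _ => (measurableSet_sub_eq _ _ _).compl

/-- The event says that `(k, j)` is the last meeting; the future after a meeting is again a pair of
independent walks from one site. -/
lemma twoStepSequences_lastMeet (k j : ℕ) :
    twoStepSequences μ {p | stepSum k p.1 - stepSum j p.2 = 0 ∧
      (seqShift k p.1, seqShift j p.2) ∈ noReturn d} =
      twoStepSequences μ {p | stepSum k p.1 - stepSum j p.2 = 0} *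
        twoStepSequences μ (noReturn d) := by
  have hset : {p : (ℕ → Fin d → ℤ) × (ℕ → Fin d → ℤ) | stepSum k p.1 - stepSum j p.2 = 0 ∧
      (seqShift k p.1, seqShift j p.2) ∈ noReturn d} =
      ⋃ v, {p | (stepSum k p.1 = v ∧ stepSum j p.2 = v) ∧
        (seqShift k p.1, seqShift j p.2) ∈ noReturn d} := by
    ext p
    simp only [Set.mem_ofPred_eq, Set.mem_iUnion]
    constructor
    · rintro ⟨h, h'⟩
      exact ⟨_, ⟨sub_eq_zero.1 h, rfl⟩, h'⟩
    · rintro ⟨v, ⟨h1, h2⟩, h3⟩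
      exact ⟨by rw [h1, h2, sub_self], h3⟩
  rw [hset, measure_iUnion, twoStepSequences_sub_eq, ← ENNReal.tsum_mul_right]
  · refine tsum_congr fun v => ?_
    rw [twoStepSequences_stepSum_seqShift μ k j v v measurableSet_noReturn, add_zero]
  · intro v v' hv
    rw [Function.onFun, Set.disjoint_left]
    rintro p ⟨⟨-, h1⟩, -⟩ ⟨⟨-, h2⟩, -⟩
    exact hv (h1.symm.trans h2)
  · intro v
    exact (((measurableSet_stepSum_eq k v).preimage measurable_fst).inter
      ((measurableSet_stepSum_eq j v).preimage measurable_snd)).inter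
      (((measurable_seqShift k).prodMap (measurable_seqShift j)) measurableSet_noReturn)

variable {μ}

lemma stepSum_sub_seqShift {k j k' j' : ℕ} {p : (ℕ → Fin d → ℤ) × (ℕ → Fin d → ℤ)}
    (h : stepSum k p.1 - stepSum j p.2 = 0) :
    stepSum (k + k') p.1 - stepSum (j + j') p.2 =
      stepSum k' (seqShift k p.1) - stepSum j' (seqShift j p.2) := by
  rw [stepSum_add, stepSum_add, sub_eq_zero.1 h]; abel

/-- If the expected number of common positions is infinite, then two independent walks from the
same site meet again almost surely. -/
lemma measure_noReturn_eq_zero (hd : 1 ≤ d) (hμ : IsCarriedByPositive μ)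
    (hdiv : ∑' q : ℕ × ℕ, twoStepSequences μ {p | stepSum q.1 p.1 - stepSum q.2 p.2 = 0} = ⊤) :
    twoStepSequences μ (noReturn d) = 0 := by
  let c : Fin d := ⟨0, hd⟩
  let T : ℕ × ℕ → Set ((ℕ → Fin d → ℤ) × (ℕ → Fin d → ℤ)) := fun q =>
    {p | stepSum q.1 p.1 - stepSum q.2 p.2 = 0 ∧
      (seqShift q.1 p.1, seqShift q.2 p.2) ∈ noReturn d}
  have hT : ∀ q, NullMeasurableSet (T q) (twoStepSequences μ) := fun q =>
    ((measurableSet_sub_eq q.1 q.2 0).inter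
      (((measurable_seqShift q.1).prodMap (measurable_seqShift q.2))
        measurableSet_noReturn)).nullMeasurableSet
  -- Of two comparable last meetings, the later one would be a return after the earlier one.
  have hle : ∀ q q' : ℕ × ℕ, ∀ p, p ∈ T q → p ∈ T q' → q.1 ≤ q'.1 → q.2 ≤ q'.2 → q = q' := by
    rintro ⟨k, j⟩ ⟨k', j'⟩ p h1 h2 hk hj
    obtain ⟨m, rfl⟩ := Nat.exists_eq_add_of_le hk
    obtain ⟨n, rfl⟩ := Nat.exists_eq_add_of_le hj
    by_contra hne
    have hmn : (m, n) ≠ (0, 0) := by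
      rintro h
      obtain ⟨rfl, rfl⟩ := Prod.ext_iff.1 h
      exact hne rfl
    exact h1.2 m n hmn ((stepSum_sub_seqShift h1.1).symm.trans h2.1)
  have hdisj : Pairwise fun q q' => AEDisjoint (twoStepSequences μ) (T q) (T q') := by
    intro q q' hq
    refine measure_mono_null (t := {p | ¬ ((∀ n c, 1 ≤ p.1 n c) ∧ ∀ n c, 1 ≤ p.2 n c)}) ?_
      (ae_twoStepSequences_pos hμ)
    intro p hp hpos
    have hw : ∀ r : ℕ × ℕ, p ∈ T r → walk 0 p.1 r.1 = walk 0 p.2 r.2 := by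
      intro r hr
      have := sub_eq_zero.1 hr.1
      simpa [walk, stepSum] using this
    have h1 := hw q hp.1
    have h2 := hw q' hp.2
    have ha : ∀ i, 1 ≤ p.1 i c := fun i => hpos.1 i c
    have hb : ∀ i, 1 ≤ p.2 i c := fun i => hpos.2 i c
    rcases lt_trichotomy q.1 q'.1 with h | h | h
    · exact hq (hle q q' p hp.1 hp.2 h.le (walk_meet_lt ha hb h1 h2 h).le)
    · exact hq (Prod.ext h (walk_meet_eq hb h1 (h ▸ h2)))
    · exact hq (hle q' q p hp.2 hp.1 h.le (walk_meet_lt ha hb h2 h1 h).le).symm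
  -- Last-meeting events are disjoint, so their probabilities sum to at most 1. An infinite expected
  -- number of meetings forces the other factor to vanish.
  have hsum : (∑' q : ℕ × ℕ, twoStepSequences μ {p | stepSum q.1 p.1 - stepSum q.2 p.2 = 0}) *
      twoStepSequences μ (noReturn d) ≤ 1 := by
    rw [← ENNReal.tsum_mul_right]
    calc _ = ∑' q, twoStepSequences μ (T q) :=
          tsum_congr fun q => (twoStepSequences_lastMeet μ q.1 q.2).symm
      _ = twoStepSequences μ (⋃ q, T q) := (measure_iUnion₀ hdisj hT).symm
      _ ≤ 1 := prob_le_one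
  by_contra h0
  rw [hdiv, ENNReal.top_mul h0] at hsum
  exact absurd hsum (by simp)

/-- The walks are at distance `w` infinitely often. -/
def meetOften (w : Fin d → ℤ) : Set ((ℕ → Fin d → ℤ) × (ℕ → Fin d → ℤ)) :=
  {p | ∀ N, ∃ k ≥ N, ∃ j ≥ N, stepSum k p.1 - stepSum j p.2 = w}

lemma measurableSet_meetOften (w : Fin d → ℤ) : MeasurableSet (meetOften w) := by
  have : meetOften w = ⋂ N : ℕ, ⋃ k : ℕ, ⋃ _ : k ≥ N, ⋃ j : ℕ, ⋃ _ : j ≥ N,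
      {p | stepSum k p.1 - stepSum j p.2 = w} := by
    ext p; simp [meetOften]
  rw [this]
  exact .iInter fun N => .iUnion fun k => .iUnion fun _ => .iUnion fun j => .iUnion fun _ =>
    measurableSet_sub_eq k j w

lemma measure_compl_meetOften_zero (hd : 1 ≤ d) (hμ : IsCarriedByPositive μ)
    (hdiv : ∑' q : ℕ × ℕ, twoStepSequences μ {p | stepSum q.1 p.1 - stepSum q.2 p.2 = 0} = ⊤) :
    twoStepSequences μ (meetOften (0 : Fin d → ℤ))ᶜ = 0 := by
  let c : Fin d := ⟨0, hd⟩
  have h0 := measure_noReturn_eq_zero hd hμ hdiv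
  have h1 : ∀ᵐ p ∂twoStepSequences μ, ∀ q : ℕ × ℕ,
      ¬ (stepSum q.1 p.1 - stepSum q.2 p.2 = 0 ∧
        (seqShift q.1 p.1, seqShift q.2 p.2) ∈ noReturn d) := by
    rw [ae_all_iff]
    intro q
    have := twoStepSequences_lastMeet μ q.1 q.2
    rw [h0, mul_zero] at this
    exact measure_eq_zero_iff_ae_notMem.1 this
  have : ∀ᵐ p ∂twoStepSequences μ, p ∈ meetOften (0 : Fin d → ℤ) := by
    filter_upwards [h1, ae_twoStepSequences_pos hμ] with p hp hpos N
    induction N with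
    | zero => exact ⟨0, le_rfl, 0, le_rfl, by simp⟩
    | succ N ih =>
      obtain ⟨k, hk, j, hj, hkj⟩ := ih
      have h2 : (seqShift k p.1, seqShift j p.2) ∉ noReturn d := fun h => hp (k, j) ⟨hkj, h⟩
      simp only [noReturn, Set.mem_ofPred_eq, not_forall, not_not] at h2
      obtain ⟨m, n, hmn, h3⟩ := h2
      have ha : ∀ i, 1 ≤ seqShift k p.1 i c := fun i => hpos.1 _ c
      have hb : ∀ i, 1 ≤ seqShift j p.2 i c := fun i => hpos.2 _ c
      -- If only one of the walks had advanced, a positive displacement would equal 0. So both times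
      -- strictly increase.
      have h4 : stepSum m (seqShift k p.1) c = stepSum n (seqShift j p.2) c :=
        congrFun (sub_eq_zero.1 h3) c
      have hm : m ≠ 0 := by
        rintro rfl
        have := stepSum_pos hb (k := n) (by rintro rfl; exact hmn rfl)
        rw [← h4] at this
        simp at this
      have hn : n ≠ 0 := by
        rintro rfl
        have := stepSum_pos ha hm
        rw [h4] at this
        simp at this
      exact ⟨k + m, by omega, j + n, by omega, (stepSum_sub_seqShift hkj).trans h3⟩
  exact this

lemma meetOften_step {w v u : Fin d → ℤ} {k j : ℕ}
    {p : (ℕ → Fin d → ℤ) × (ℕ → Fin d → ℤ)} (hv : stepSum k p.1 = v) (hu : stepSum j p.2 = u)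
    (h : p ∈ meetOften w) : (seqShift k p.1, seqShift j p.2) ∈ meetOften (w - v + u) := by
  intro N
  obtain ⟨m, hm, n, hn, hmn⟩ := h (N + k + j)
  obtain ⟨m, rfl⟩ := Nat.exists_eq_add_of_le (show k ≤ m by omega)
  obtain ⟨n, rfl⟩ := Nat.exists_eq_add_of_le (show j ≤ n by omega)
  refine ⟨m, by omega, n, by omega, ?_⟩
  rw [stepSum_add, stepSum_add, hv, hu] at hmn
  rw [← hmn]
  abel

/-- The displacements `v`, `u` occur with positive probability and are independent of the future, so
an almost sure property of the pair holds from the shifted starting positions as well. -/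
lemma measure_compl_meetOften_step {w v u : Fin d → ℤ} {k j : ℕ} (hv : sumMass μ k v ≠ 0)
    (hu : sumMass μ j u ≠ 0) (h : twoStepSequences μ (meetOften w)ᶜ = 0) :
    twoStepSequences μ (meetOften (w - v + u))ᶜ = 0 := by
  have h1 := twoStepSequences_stepSum_seqShift μ k j v u (measurableSet_meetOften (w - v + u)).compl
  rw [measure_mono_null _ h] at h1
  · simpa [hv, hu] using h1.symm
  · rintro p ⟨⟨h2, h3⟩, h4⟩ h5
    exact h4 (meetOften_step h2 h3 h5)

/-- If the expected number of common positions is infinite, then two independent walks with an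
aperiodic step law meet infinitely often, wherever they start. -/
lemma measure_compl_meetOften (hd : 1 ≤ d) (hμ : IsCarriedByPositive μ) (haper : IsAperiodic μ)
    (hdiv : ∑' q : ℕ × ℕ, twoStepSequences μ {p | stepSum q.1 p.1 - stepSum q.2 p.2 = 0} = ⊤)
    (w : Fin d → ℤ) : twoStepSequences μ (meetOften w)ᶜ = 0 := by
  -- For a generator `c`, one step `c` of the second walk changes `w` to `w + c`, and one step `c`
  -- of the first walk undoes it. Hence an equivalence, which is stable under group operations.
  have key : ∀ c ∈ AddSubgroup.closure {k : Fin d → ℤ | μ {k} ≠ 0}, ∀ w : Fin d → ℤ,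
      twoStepSequences μ (meetOften w)ᶜ = 0 ↔ twoStepSequences μ (meetOften (w + c))ᶜ = 0 := by
    intro c hc
    induction hc using AddSubgroup.closure_induction with
    | mem c hc =>
      have h0 : sumMass μ 0 (0 : Fin d → ℤ) ≠ 0 := by simp [sumMass_zero]
      have h1 : sumMass μ 1 c ≠ 0 := by rw [sumMass_one]; exact hc
      intro w
      constructor
      · intro h
        simpa using measure_compl_meetOften_step h0 h1 h
      · intro h
        simpa using measure_compl_meetOften_step h1 h0 h
    | zero => simp
    | add c c' _ _ h h' =>
      intro w
      rw [h w, h' (w + c), add_assoc]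
    | neg c _ h =>
      intro w
      rw [h (w + -c), neg_add_cancel_right]
  have := (key w (by rw [haper]; trivial) 0).1 (measure_compl_meetOften_zero hd hμ hdiv)
  simpa using this

/-- If two independent walks have infinitely many common positions in expectation, then the graph
is almost surely connected. -/
theorem ae_forall_linesMeet (hd : 1 ≤ d) (hμ : IsCarriedByPositive μ) (haper : IsAperiodic μ)
    (hdiv : ∑' q : ℕ × ℕ, twoStepSequences μ {p | stepSum q.1 p.1 - stepSum q.2 p.2 = 0} = ⊤) :
    ∀ᵐ z ∂Measure.infinitePi (fun _ : Fin d → ℤ => μ), ∀ x y, LinesMeet z x y := by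
  rw [ae_all_iff]
  intro x
  rw [ae_all_iff]
  intro y
  have h1 : ∀ᵐ p ∂twoStepSequences μ, ∃ k j, walk x p.1 k = walk y p.2 j := by
    have h0 : ∀ᵐ p ∂twoStepSequences μ, p ∈ meetOften (x - y) :=
      measure_compl_meetOften hd hμ haper hdiv (x - y)
    filter_upwards [h0] with p hp
    obtain ⟨k, -, j, -, h⟩ := hp 0
    refine ⟨k, j, ?_⟩
    change x - stepSum k p.1 = y - stepSum j p.2
    rw [sub_eq_sub_iff_add_eq_add] at h ⊢
    rw [← h, add_comm]
  have h2 : (1 : ENNReal) ≤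
      Measure.infinitePi (fun _ : Fin d → ℤ => μ) {z | LinesMeet z x y} := by
    refine le_trans ?_ (le_measure_linesMeet hd hμ x y)
    rw [← measure_univ (μ := twoStepSequences μ)]
    exact measure_mono_ae (h1.mono fun p hp _ => hp)
  have hmeas : MeasurableSet {z : (Fin d → ℤ) → (Fin d → ℤ) | LinesMeet z x y} := by
    have : {z : (Fin d → ℤ) → (Fin d → ℤ) | LinesMeet z x y} =
        ⋃ k, ⋃ j, {z | (ancestor z)^[k] x = (ancestor z)^[j] y} := by
      ext z; simp [LinesMeet]
    rw [this]
    exact .iUnion fun k => .iUnion fun j => measurableSet_eq_fun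
      (measurable_ancestor_iterate x k) (measurable_ancestor_iterate y j)
  exact (mem_ae_iff_prob_eq_one hmeas).2 (le_antisymm prob_le_one h2)

end Recurrence

/-! ### The renewal function is not square summable when `∑ 1 / α j ≤ 2`. -/

section Divergence

variable {d : ℕ} (μ : Measure (Fin d → ℤ)) [IsProbabilityMeasure μ]

/-- The expected number of visits to `v` of a walk with step law `μ`. -/
noncomputable def renewalMass (v : Fin d → ℤ) : ENNReal := ∑' k, sumMass μ k v

/-- The expected number of common positions of two walks is the squared `ℓ²` norm of the renewal
function. -/
lemma tsum_twoStepSequences_eq :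
    ∑' q : ℕ × ℕ, twoStepSequences μ {p | stepSum q.1 p.1 - stepSum q.2 p.2 = 0} =
      ∑' v, renewalMass μ v ^ 2 := by
  calc _ = ∑' q : ℕ × ℕ, ∑' v, sumMass μ q.1 v * sumMass μ q.2 v :=
        tsum_congr fun q => by rw [twoStepSequences_sub_eq]; simp only [add_zero]
    _ = ∑' v, ∑' q : ℕ × ℕ, sumMass μ q.1 v * sumMass μ q.2 v := ENNReal.tsum_comm
    _ = _ := by
        refine tsum_congr fun v => ?_
        rw [ENNReal.tsum_prod (f := fun k j => sumMass μ k v * sumMass μ j v)]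
        simp only [ENNReal.tsum_mul_left, ENNReal.tsum_mul_right]
        rw [sq]
        rfl

lemma sum_sumMass_toReal (k : ℕ) (B : Finset (Fin d → ℤ)) :
    ∑ v ∈ B, (sumMass μ k v).toReal =
      (Measure.infinitePi (fun _ : ℕ => μ) {a | stepSum k a ∈ B}).toReal := by
  rw [← ENNReal.toReal_sum fun v _ => sumMass_ne_top μ k v]
  congr 1
  have : {a : ℕ → Fin d → ℤ | stepSum k a ∈ B} = ⋃ v ∈ B, {a | stepSum k a = v} := by
    ext a; simp
  rw [this, measure_biUnion_finset]
  · rfl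
  · intro v _ v' _ hv
    rw [Function.onFun, Set.disjoint_left]
    exact fun a h1 h2 => hv (h1.symm.trans h2)
  · exact fun v _ => measurableSet_stepSum_eq k v

lemma stepSum_mono {a : ℕ → Fin d → ℤ} {c : Fin d} (ha : ∀ i, 1 ≤ a i c) {k n : ℕ} (hk : k ≤ n) :
    stepSum k a c ≤ stepSum n a c := by
  obtain ⟨m, rfl⟩ := Nat.exists_eq_add_of_le hk
  rw [stepSum_add, Pi.add_apply]
  rcases eq_or_ne m 0 with rfl | hm
  · simp
  · have := stepSum_pos (a := seqShift k a) (c := c) (fun i => ha _) hm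
    omega

/-- The lattice points of the box with sides `C * n ^ (1 / α j)`. -/
noncomputable def latticeBox (α : Fin d → ℝ) (C : ℝ) (n : ℕ) : Finset (Fin d → ℤ) :=
  Fintype.piFinset fun j => Finset.Icc 0 ⌊C * (n : ℝ) ^ (1 / α j)⌋

lemma mem_latticeBox {α : Fin d → ℝ} {C : ℝ} {n : ℕ} {v : Fin d → ℤ} :
    v ∈ latticeBox α C n ↔ ∀ j, 0 ≤ v j ∧ (v j : ℝ) ≤ C * (n : ℝ) ^ (1 / α j) := by
  simp [latticeBox, Fintype.mem_piFinset, Int.le_floor]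

lemma card_latticeBox_le {α : Fin d → ℝ} (hα : ∀ i, 0 < α i) {C : ℝ} (hC : 0 < C) {n : ℕ}
    (hn : 1 ≤ n) :
    ((latticeBox α C n).card : ℝ) ≤ (C + 1) ^ d * (n : ℝ) ^ (∑ j, 1 / α j) := by
  have hn' : (1 : ℝ) ≤ n := by exact_mod_cast hn
  rw [latticeBox, Fintype.card_piFinset, Real.rpow_sum_of_pos (by linarith), Nat.cast_prod]
  calc _ ≤ ∏ j : Fin d, (C + 1) * (n : ℝ) ^ (1 / α j) := by
        refine Finset.prod_le_prod (fun _ _ => by positivity) fun j _ => ?_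
        have h1 : (1 : ℝ) ≤ (n : ℝ) ^ (1 / α j) :=
          Real.one_le_rpow hn' (by have := hα j; positivity)
        have h0 : 0 ≤ ⌊C * (n : ℝ) ^ (1 / α j)⌋ := Int.floor_nonneg.2 (by positivity)
        have h2 := Int.floor_le (C * (n : ℝ) ^ (1 / α j))
        rw [Int.card_Icc, sub_zero]
        have h3 : (((⌊C * (n : ℝ) ^ (1 / α j)⌋ + 1).toNat : ℕ) : ℝ) =
            (⌊C * (n : ℝ) ^ (1 / α j)⌋ : ℝ) + 1 := by
          have : (((⌊C * (n : ℝ) ^ (1 / α j)⌋ + 1).toNat : ℕ) : ℤ) =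
            ⌊C * (n : ℝ) ^ (1 / α j)⌋ + 1 := Int.toNat_of_nonneg (by omega)
          exact_mod_cast this
        rw [h3]
        linarith
    _ = _ := by simp [Finset.prod_mul_distrib]

variable {μ}

/-- Coordinates only increase along a walk, so an upper bound at time `n` confines all earlier
positions to the same box. -/
lemma half_le_sum_sumMass (hμ : IsCarriedByPositive μ) {α : Fin d → ℝ} {C : ℝ} {n k : ℕ}
    (hk : k ≤ n) (hn : (1 / 2 : ℝ) ≤ (Measure.infinitePi (fun _ : ℕ => μ)
      {a | ∀ j, (stepSum n a j : ℝ) ≤ C * (n : ℝ) ^ (1 / α j)}).toReal) :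
    (1 / 2 : ℝ) ≤ ∑ v ∈ latticeBox α C n, (sumMass μ k v).toReal := by
  rw [sum_sumMass_toReal]
  refine hn.trans (ENNReal.toReal_mono (measure_ne_top _ _) (measure_mono_ae ?_))
  filter_upwards [ae_infinitePi_pos (ι := ℕ) hμ] with a ha h
  refine mem_latticeBox.2 fun j => ⟨?_, ?_⟩
  · simpa using stepSum_mono (fun i => ha i j) (Nat.zero_le k)
  · refine le_trans ?_ (h j)
    exact_mod_cast stepSum_mono (fun i => ha i j) hk

/-- If the normalized walks are tight and the homogeneous dimension `∑ 1 / α j` is at most `2`, then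
the renewal function is not square summable. -/
theorem tsum_twoStepSequences_eq_top (hμ : IsCarriedByPositive μ) {α : Fin d → ℝ}
    (hα : ∀ i, 0 < α i) (hq : ∑ j, 1 / α j ≤ 2) {C : ℝ} (hC : 0 < C)
    (htight : ∀ᶠ n : ℕ in atTop, (1 / 2 : ℝ) ≤ (Measure.infinitePi (fun _ : ℕ => μ)
      {a | ∀ j, (stepSum n a j : ℝ) ≤ C * (n : ℝ) ^ (1 / α j)}).toReal) :
    ∑' q : ℕ × ℕ, twoStepSequences μ {p | stepSum q.1 p.1 - stepSum q.2 p.2 = 0} = ⊤ := by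
  classical
  rw [tsum_twoStepSequences_eq]
  by_contra hfin
  have hG : ∀ v, renewalMass μ v ≠ ⊤ := by
    intro v hv
    refine ENNReal.ne_top_of_tsum_ne_top hfin v ?_
    simp [hv]
  let g : (Fin d → ℤ) → ℝ := fun v => (renewalMass μ v).toReal
  have hg0 : ∀ v, 0 ≤ g v := fun v => ENNReal.toReal_nonneg
  have hsum : Summable fun v => g v ^ 2 := by
    have := ENNReal.summable_toReal hfin
    simpa [g, ENNReal.toReal_pow] using this
  set K : ℝ := (C + 1) ^ d with hK
  have hKpos : 0 < K := by positivity
  -- Off the finite set `F` the squares sum to less than `1 / (16 K)`. Against at most `K n²`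
  -- points, Cauchy–Schwarz leaves at most `n / 4`. Then `n` is taken so large that `F` contributes
  -- less than `n / 4`, contradicting the total of at least `n / 2`.
  obtain ⟨F, hF⟩ := summable_iff_vanishing_norm.1 hsum (1 / (16 * K)) (by positivity)
  obtain ⟨n, hn, hn1, hnF⟩ := (htight.and ((eventually_ge_atTop 1).and
    (eventually_gt_atTop ⌈4 * ∑ v ∈ F, g v⌉₊))).exists
  have hn' : (1 : ℝ) ≤ n := by exact_mod_cast hn1
  have hnF' : 4 * ∑ v ∈ F, g v < n := (Nat.le_ceil _).trans_lt (by exact_mod_cast hnF)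
  set B := latticeBox α C n with hB
  have hlow : (n : ℝ) / 2 ≤ ∑ v ∈ B, g v := by
    calc (n : ℝ) / 2 = ∑ k ∈ Finset.range n, (1 / 2 : ℝ) := by simp; ring
      _ ≤ ∑ k ∈ Finset.range n, ∑ v ∈ B, (sumMass μ k v).toReal :=
          Finset.sum_le_sum fun k hk =>
            half_le_sum_sumMass hμ (Finset.mem_range.1 hk).le hn
      _ = ∑ v ∈ B, ∑ k ∈ Finset.range n, (sumMass μ k v).toReal := Finset.sum_comm
      _ ≤ ∑ v ∈ B, g v := by
          refine Finset.sum_le_sum fun v _ => ?_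
          rw [← ENNReal.toReal_sum fun k _ => sumMass_ne_top μ k v]
          exact ENNReal.toReal_mono (hG v) (ENNReal.sum_le_tsum _)
  have hcard : ((B \ F).card : ℝ) ≤ K * (n : ℝ) ^ 2 := by
    calc ((B \ F).card : ℝ) ≤ (B.card : ℝ) := by
          exact_mod_cast Finset.card_le_card Finset.sdiff_subset
      _ ≤ K * (n : ℝ) ^ (∑ j, 1 / α j) := card_latticeBox_le hα hC hn1
      _ ≤ K * (n : ℝ) ^ (2 : ℝ) := by
          gcongr
      _ = K * (n : ℝ) ^ 2 := by norm_num
  have htail : ∑ v ∈ B \ F, g v ^ 2 ≤ 1 / (16 * K) := by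
    have := hF (B \ F) Finset.sdiff_disjoint
    rw [Real.norm_eq_abs] at this
    exact (le_abs_self _).trans this.le
  have hout : ∑ v ∈ B \ F, g v ≤ (n : ℝ) / 4 := by
    refine abs_le_of_sq_le_sq' ?_ (by positivity) |>.2
    calc (∑ v ∈ B \ F, g v) ^ 2 ≤ (B \ F).card * ∑ v ∈ B \ F, g v ^ 2 :=
          sq_sum_le_card_mul_sum_sq
      _ ≤ (K * (n : ℝ) ^ 2) * (1 / (16 * K)) := by
          gcongr
      _ = ((n : ℝ) / 4) ^ 2 := by field_simp; norm_num
  have hin : ∑ v ∈ B ∩ F, g v ≤ ∑ v ∈ F, g v :=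
    Finset.sum_le_sum_of_subset_of_nonneg Finset.inter_subset_right fun v _ _ => hg0 v
  have := Finset.sum_inter_add_sum_sdiff B F g
  linarith

end Divergence

/-! ### Normalized sums: weak convergence and tightness. -/

section WeakConvergence

open scoped Topology BoundedContinuousFunction

variable {d : ℕ}

/-- The diagonally normalized sum of the first `n` steps. -/
noncomputable def scaledSum (α : Fin d → ℝ) (n : ℕ) (a : ℕ → Fin d → ℤ) : Fin d → ℝ :=
  fun j => (n : ℝ) ^ (-(1 / α j)) * (stepSum n a j : ℝ)

lemma measurable_scaledSum (α : Fin d → ℝ) (n : ℕ) : Measurable (scaledSum α n) := by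
  refine measurable_pi_iff.2 fun j => ?_
  have h : Measurable fun a : ℕ → Fin d → ℤ => stepSum n a j :=
    (measurable_pi_apply j).comp (measurable_stepSum n)
  exact ((measurable_from_top (f := fun m : ℤ => (m : ℝ))).comp h).const_mul _

lemma matrixRPow_mulVec_eq_scaledSum (α : Fin d → ℝ) (n : ℕ) (a : ℕ → Fin d → ℤ) :
    (matrixRPow (n : ℝ) (-Matrix.diagonal fun i => 1 / α i)).mulVec
      (∑ i ∈ Finset.range n, fun j => (a i j : ℝ)) = scaledSum α n a := by
  rcases Nat.eq_zero_or_pos n with rfl | hn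
  · ext j
    simp [scaledSum]
  · have hn' : (0 : ℝ) < n := by exact_mod_cast hn
    have h : Real.log n • (-Matrix.diagonal fun i => 1 / α i) =
        Matrix.diagonal fun i => Real.log n * -(1 / α i) := by
      rw [Matrix.diagonal_neg, ← Matrix.diagonal_smul]
      rfl
    ext j
    rw [matrixRPow, h, Matrix.exp_diagonal, Matrix.mulVec_diagonal, Pi.coe_exp,
      ← Real.exp_eq_exp_ℝ, ← Real.rpow_def_of_pos hn', scaledSum, stepSum]
    simp

variable {μ : Measure (Fin d → ℤ)} [IsProbabilityMeasure μ] {ν : Measure (Fin d → ℝ)}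
  [IsProbabilityMeasure ν] {α : Fin d → ℝ}

/-- Weak convergence of the normalized sums, tested against bounded continuous functions. -/
def ScaledSumsConverge (α : Fin d → ℝ) (μ : Measure (Fin d → ℤ)) [IsProbabilityMeasure μ]
    (ν : Measure (Fin d → ℝ)) : Prop :=
  ∀ f : (Fin d → ℝ) →ᵇ ℂ, Tendsto
    (fun n => ∫ a, f (scaledSum α n a) ∂Measure.infinitePi (fun _ : ℕ => μ)) atTop
    (𝓝 (∫ x, f x ∂ν))

lemma InStrictDomainOfNormalAttraction.scaledSumsConverge
    (h : InStrictDomainOfNormalAttraction (Matrix.diagonal fun i => 1 / α i) ν μ) :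
    ScaledSumsConverge α μ ν := by
  intro f
  have h1 := (ProbabilityMeasure.tendsto_iff_forall_integral_rclike_tendsto ℂ).1 h.tendsto f
  simp only [ProbabilityMeasure.coe_mk, Measure.map_id, matrixRPow_mulVec_eq_scaledSum] at h1
  convert h1 using 2 with n
  exact (integral_map (measurable_scaledSum α n).aemeasurable
    f.continuous.aestronglyMeasurable).symm

/-- The function `min 2 (r ‖x‖)`. -/
noncomputable def clippedNorm (r : ℝ) (x : Fin d → ℝ) : ℝ := min 2 (r * ‖x‖)

lemma continuous_clippedNorm (r : ℝ) : Continuous (clippedNorm (d := d) r) := by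
  unfold clippedNorm; fun_prop

lemma clippedNorm_nonneg {r : ℝ} (hr : 0 ≤ r) (x : Fin d → ℝ) : 0 ≤ clippedNorm r x :=
  le_min (by norm_num) (by positivity)

lemma norm_clippedNorm_le {r : ℝ} (hr : 0 ≤ r) (x : Fin d → ℝ) : ‖clippedNorm r x‖ ≤ 2 := by
  rw [Real.norm_eq_abs, abs_of_nonneg (clippedNorm_nonneg hr x)]
  exact min_le_left _ _

/-- Quantitative tightness: under `ν` the integral tends to 0 with `r` by dominated convergence, and
for fixed `r` weak convergence transfers the bound to large `n`. -/
lemma exists_integral_clippedNorm_lt (h : ScaledSumsConverge α μ ν) {ε : ℝ} (hε : 0 < ε) :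
    ∃ r > 0, ∀ᶠ n in atTop,
      ∫ a, clippedNorm r (scaledSum α n a) ∂Measure.infinitePi (fun _ : ℕ => μ) < ε := by
  have h0 : Tendsto (fun r => ∫ x, clippedNorm r x ∂ν) (𝓝[>] 0) (𝓝 (∫ x : Fin d → ℝ, 0 ∂ν)) := by
    refine tendsto_integral_filter_of_dominated_convergence (fun _ => 2) ?_ ?_ ?_ ?_
    · exact .of_forall fun r => (continuous_clippedNorm r).aestronglyMeasurable
    · filter_upwards [self_mem_nhdsWithin] with r hr
      exact .of_forall fun x => norm_clippedNorm_le (le_of_lt hr) x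
    · exact integrable_const _
    · refine .of_forall fun x => ?_
      have : Tendsto (fun r : ℝ => min 2 (r * ‖x‖)) (𝓝 0) (𝓝 (min 2 (0 * ‖x‖))) := by
        have : Continuous fun r : ℝ => min 2 (r * ‖x‖) := by fun_prop
        exact this.tendsto 0
      simp only [zero_mul, min_eq_right (zero_le_two : (0 : ℝ) ≤ 2)] at this
      exact this.mono_left nhdsWithin_le_nhds
  rw [integral_zero] at h0
  obtain ⟨r, hr, hr0⟩ := ((h0.eventually_lt_const hε).and self_mem_nhdsWithin).exists
  have hr0 : 0 < r := hr0
  refine ⟨r, hr0, ?_⟩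
  let f : (Fin d → ℝ) →ᵇ ℂ := BoundedContinuousFunction.ofNormedAddCommGroup
    (fun x => (clippedNorm r x : ℂ)) (Complex.continuous_ofReal.comp (continuous_clippedNorm r)) 2
    (fun x => by rw [Complex.norm_real]; exact norm_clippedNorm_le hr0.le x)
  have h1 := (Complex.continuous_re.tendsto _).comp (h f)
  have h2 : ∀ n, (∫ a, f (scaledSum α n a) ∂Measure.infinitePi (fun _ : ℕ => μ)) =
      ((∫ a, clippedNorm r (scaledSum α n a) ∂Measure.infinitePi (fun _ : ℕ => μ) : ℝ) : ℂ) :=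
    fun n => integral_ofReal
  have h3 : (∫ x, f x ∂ν) = ((∫ x, clippedNorm r x ∂ν : ℝ) : ℂ) := integral_ofReal
  rw [h3] at h1
  have h4 : Tendsto (fun n => ∫ a, clippedNorm r (scaledSum α n a)
      ∂Measure.infinitePi (fun _ : ℕ => μ)) atTop (𝓝 (∫ x, clippedNorm r x ∂ν)) := by
    refine h1.congr fun n => ?_
    simp only [Function.comp_apply, h2, Complex.ofReal_re]
  exact h4.eventually_lt_const hr

lemma integrable_clippedNorm_scaledSum {r : ℝ} (hr : 0 ≤ r) (n : ℕ) :
    Integrable (fun a => clippedNorm r (scaledSum α n a))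
      (Measure.infinitePi (fun _ : ℕ => μ)) :=
  .of_bound ((continuous_clippedNorm r).measurable.comp
    (measurable_scaledSum α n)).aestronglyMeasurable 2
    (.of_forall fun _ => norm_clippedNorm_le hr _)

/-- The normalized sums are tight. -/
lemma exists_half_le_measure (h : ScaledSumsConverge α μ ν) :
    ∃ C > 0, ∀ᶠ n : ℕ in atTop, (1 / 2 : ℝ) ≤ (Measure.infinitePi (fun _ : ℕ => μ)
      {a | ∀ j, (stepSum n a j : ℝ) ≤ C * (n : ℝ) ^ (1 / α j)}).toReal := by
  obtain ⟨r, hr, hev⟩ := exists_integral_clippedNorm_lt h (ε := 1) one_pos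
  -- The clipped norm reaches 2 exactly when `‖x‖ ≥ 2 / r`. As its mean is below 1, Markov's
  -- inequality bounds that probability by 1/2.
  refine ⟨2 / r, by positivity, ?_⟩
  filter_upwards [hev, eventually_ge_atTop 1] with n hn hn1
  have hn' : (0 : ℝ) < n := by exact_mod_cast hn1
  set P := Measure.infinitePi (fun _ : ℕ => μ)
  have hmeas : MeasurableSet {a | 2 ≤ clippedNorm r (scaledSum α n a)} :=
    measurableSet_le measurable_const
      ((continuous_clippedNorm r).measurable.comp (measurable_scaledSum α n))
  have hmark := mul_meas_ge_le_integral_of_nonneg (μ := P)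
    (.of_forall fun a => clippedNorm_nonneg hr.le (scaledSum α n a))
    (integrable_clippedNorm_scaledSum hr.le n) 2
  have h1 : P.real {a | 2 ≤ clippedNorm r (scaledSum α n a)} ≤ 1 / 2 := by linarith
  have h2 := probReal_compl_eq_one_sub (μ := P) hmeas
  have h3 : P.real {a | 2 ≤ clippedNorm r (scaledSum α n a)}ᶜ ≤
      P.real {a | ∀ j, (stepSum n a j : ℝ) ≤ 2 / r * (n : ℝ) ^ (1 / α j)} := by
    refine measureReal_mono fun a ha j => ?_
    have ha : ¬ 2 ≤ clippedNorm r (scaledSum α n a) := ha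
    have h4 : r * ‖scaledSum α n a‖ < 2 := by
      by_contra hcon
      exact ha (le_min le_rfl (not_lt.1 hcon))
    have h5 := (le_abs_self _).trans (norm_le_pi_norm (scaledSum α n a) j)
    have h6 : scaledSum α n a j ≤ 2 / r := by
      rw [le_div_iff₀ hr]; nlinarith
    rw [scaledSum, Real.rpow_neg hn'.le, inv_mul_eq_div, div_le_iff₀ (by positivity)] at h6
    exact h6
  change _ ≤ P.real _
  linarith

end WeakConvergence

/-! ### Characteristic functions of the steps, the normalized sums and the limit. -/

section CharacteristicFunction

open scoped Topology BoundedContinuousFunction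

variable {d : ℕ}

/-- The additive character `x ↦ exp (i θ · x)`. -/
noncomputable def planeWave (θ x : Fin d → ℝ) : ℂ := Complex.exp ((θ ⬝ᵥ x : ℝ) * Complex.I)

lemma norm_planeWave (θ x : Fin d → ℝ) : ‖planeWave θ x‖ = 1 := Complex.norm_exp_ofReal_mul_I _

lemma continuous_dotProduct_pair :
    Continuous fun p : (Fin d → ℝ) × (Fin d → ℝ) => p.1 ⬝ᵥ p.2 := by
  unfold dotProduct; fun_prop

lemma continuous_planeWave_pair :
    Continuous fun p : (Fin d → ℝ) × (Fin d → ℝ) => planeWave p.1 p.2 :=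
  Complex.continuous_exp.comp
    ((Complex.continuous_ofReal.comp continuous_dotProduct_pair).mul continuous_const)

lemma continuous_planeWave (θ : Fin d → ℝ) : Continuous (planeWave θ) :=
  continuous_planeWave_pair.comp (Continuous.prodMk_right θ)

lemma abs_dotProduct_le (θ x : Fin d → ℝ) : |θ ⬝ᵥ x| ≤ d * (‖θ‖ * ‖x‖) := by
  calc |θ ⬝ᵥ x| ≤ ∑ j, |θ j * x j| := Finset.abs_sum_le_sum_abs _ _
    _ ≤ ∑ _j : Fin d, ‖θ‖ * ‖x‖ := by
        refine Finset.sum_le_sum fun j _ => ?_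
        rw [abs_mul]
        exact mul_le_mul (norm_le_pi_norm θ j) (norm_le_pi_norm x j) (abs_nonneg _) (norm_nonneg _)
    _ = _ := by simp

lemma norm_planeWave_sub_le (θ θ' x : Fin d → ℝ) :
    ‖planeWave θ x - planeWave θ' x‖ ≤ |(θ - θ') ⬝ᵥ x| := by
  have h : planeWave θ x - planeWave θ' x =
      planeWave θ' x * (Complex.exp (Complex.I * (((θ - θ') ⬝ᵥ x : ℝ))) - 1) := by
    rw [mul_sub, mul_one, planeWave, planeWave, ← Complex.exp_add, sub_dotProduct]
    congr 2
    push_cast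
    ring
  rw [h, norm_mul, norm_planeWave, one_mul]
  exact Real.norm_exp_I_mul_ofReal_sub_one_le

/-- The real vector with integer coordinates `k`. -/
def intVec (k : Fin d → ℤ) : Fin d → ℝ := fun j => (k j : ℝ)

/-- The characteristic function of a law on `ℤ^d`. -/
noncomputable def stepChar (μ : Measure (Fin d → ℤ)) (θ : Fin d → ℝ) : ℂ :=
  ∫ k, planeWave θ (intVec k) ∂μ

variable {μ : Measure (Fin d → ℤ)} [IsProbabilityMeasure μ] {ν : Measure (Fin d → ℝ)}
  {α : Fin d → ℝ}

lemma norm_stepChar_le_one (θ : Fin d → ℝ) : ‖stepChar μ θ‖ ≤ 1 := by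
  refine (norm_integral_le_of_norm_le_const (C := 1)
    (.of_forall fun k => (norm_planeWave _ _).le)).trans ?_
  simp

lemma integral_planeWave_stepSum (θ : Fin d → ℝ) (n : ℕ) :
    ∫ a, planeWave θ (intVec (stepSum n a)) ∂Measure.infinitePi (fun _ : ℕ => μ) =
      stepChar μ θ ^ n := by
  have hind : iIndepFun (fun (i : Fin n) (a : ℕ → Fin d → ℤ) => a i)
      (Measure.infinitePi (fun _ : ℕ => μ)) :=
    (iIndepFun_infinitePi (P := fun _ : ℕ => μ) (X := fun _ x => x)
      (fun _ => measurable_id)).precomp Fin.val_injective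
  have h := hind.integral_fun_prod_comp (f := fun _ k => planeWave θ (intVec k))
    (fun i => (measurable_pi_apply _).aemeasurable)
    (fun i => Measurable.of_discrete.aestronglyMeasurable)
  have h1 : ∀ a : ℕ → Fin d → ℤ, planeWave θ (intVec (stepSum n a)) =
      ∏ i : Fin n, planeWave θ (intVec (a i)) := by
    intro a
    have : intVec (stepSum n a) = ∑ i : Fin n, intVec (a i) := by
      ext j
      simp [intVec, stepSum, Finset.sum_range]
    rw [this, planeWave, dotProduct_sum]
    simp only [planeWave]
    rw [← Complex.exp_sum, Complex.ofReal_sum, Finset.sum_mul]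
  simp only [h1]
  rw [h]
  have h2 : ∀ i : Fin n, ∫ a : ℕ → Fin d → ℤ, planeWave θ (intVec (a i))
      ∂Measure.infinitePi (fun _ : ℕ => μ) = stepChar μ θ := by
    intro i
    exact (measurePreserving_eval_infinitePi (fun _ : ℕ => μ) (i : ℕ)).hasLaw.integral_comp
      (f := fun k => planeWave θ (intVec k)) Measurable.of_discrete.aestronglyMeasurable
  simp [h2]

/-- The characteristic function of the normalized sums. -/
noncomputable def scaledChar (μ : Measure (Fin d → ℤ)) [IsProbabilityMeasure μ] (α : Fin d → ℝ)
    (n : ℕ) (ψ : Fin d → ℝ) : ℂ :=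
  ∫ a, planeWave ψ (scaledSum α n a) ∂Measure.infinitePi (fun _ : ℕ => μ)

lemma scaledChar_eq (n : ℕ) (ψ : Fin d → ℝ) :
    scaledChar μ α n ψ = stepChar μ (fun j => (n : ℝ) ^ (-(1 / α j)) * ψ j) ^ n := by
  rw [← integral_planeWave_stepSum, scaledChar]
  refine integral_congr_ae (.of_forall fun a => ?_)
  simp only [planeWave]
  congr 3
  simp only [dotProduct, scaledSum, intVec]
  exact Finset.sum_congr rfl fun j _ => by ring

lemma tendsto_scaledChar (h : ScaledSumsConverge α μ ν) (ψ : Fin d → ℝ) :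
    Tendsto (fun n => scaledChar μ α n ψ) atTop (𝓝 (∫ x, planeWave ψ x ∂ν)) :=
  h (BoundedContinuousFunction.ofNormedAddCommGroup (planeWave ψ) (continuous_planeWave ψ) 1
    (fun x => (norm_planeWave ψ x).le))

variable [IsProbabilityMeasure ν]

/-- Equicontinuity: with `exists_integral_clippedNorm_lt` the bound is small uniformly in large `n`,
which upgrades pointwise convergence to locally uniform estimates. -/
lemma norm_scaledChar_sub_le (n : ℕ) {ψ ψ' : Fin d → ℝ} {r : ℝ} (hr : 0 ≤ r)
    (hψ : d * ‖ψ - ψ'‖ ≤ r) :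
    ‖scaledChar μ α n ψ - scaledChar μ α n ψ'‖ ≤
      ∫ a, clippedNorm r (scaledSum α n a) ∂Measure.infinitePi (fun _ : ℕ => μ) := by
  have hint : ∀ ψ, Integrable (fun a => planeWave ψ (scaledSum α n a))
      (Measure.infinitePi (fun _ : ℕ => μ)) := fun ψ =>
    .of_bound ((continuous_planeWave ψ).measurable.comp
      (measurable_scaledSum α n)).aestronglyMeasurable 1 (.of_forall fun _ => (norm_planeWave _ _).le)
  rw [scaledChar, scaledChar, ← integral_sub (hint ψ) (hint ψ')]
  refine norm_integral_le_of_norm_le (integrable_clippedNorm_scaledSum hr n)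
    (.of_forall fun a => le_min ?_ ?_)
  · refine (norm_sub_le _ _).trans ?_
    rw [norm_planeWave, norm_planeWave]; norm_num
  · refine (norm_planeWave_sub_le _ _ _).trans ((abs_dotProduct_le _ _).trans ?_)
    rw [← mul_assoc]
    gcongr

/-- The characteristic functions of the normalized sums are bounded away from `1` locally
uniformly, where the limit is. -/
lemma exists_nhds_norm_scaledChar_le (h : ScaledSumsConverge α μ ν) {ψ : Fin d → ℝ}
    (hψ : ‖∫ x, planeWave ψ x ∂ν‖ < 1) :
    ∃ U ∈ 𝓝 ψ, ∃ ρ < 1, ∀ᶠ n in atTop, ∀ ψ' ∈ U, ‖scaledChar μ α n ψ'‖ ≤ ρ := by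
  set t := ‖∫ x, planeWave ψ x ∂ν‖ with ht
  have hε : 0 < (1 - t) / 4 := by linarith
  obtain ⟨r, hr, hev⟩ := exists_integral_clippedNorm_lt h hε
  -- The denominator `d + 1` ensures `d * ‖ψ' - ψ‖ ≤ r` and stays nonzero for `d = 0`. Convergence
  -- at `ψ` and equicontinuity each cost `(1 - t) / 4`.
  refine ⟨Metric.ball ψ (r / (d + 1)), Metric.ball_mem_nhds _ (by positivity),
    t + (1 - t) / 2, by linarith, ?_⟩
  have h1 : ∀ᶠ n in atTop, ‖scaledChar μ α n ψ‖ < t + (1 - t) / 4 :=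
    (tendsto_scaledChar h ψ).norm.eventually_lt_const (by linarith)
  filter_upwards [hev, h1] with n h2 h3 ψ' hψ'
  have h4 : d * ‖ψ' - ψ‖ ≤ r := by
    rw [Metric.mem_ball, dist_eq_norm, lt_div_iff₀ (by positivity)] at hψ'
    nlinarith [norm_nonneg (ψ' - ψ)]
  have h5 := norm_scaledChar_sub_le (μ := μ) (α := α) n hr.le h4
  have h6 := norm_sub_norm_le (scaledChar μ α n ψ') (scaledChar μ α n ψ)
  linarith

lemma exists_norm_scaledChar_le_of_isCompact (h : ScaledSumsConverge α μ ν)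
    {K : Set (Fin d → ℝ)} (hK : IsCompact K)
    (hlt : ∀ ψ ∈ K, ‖∫ x, planeWave ψ x ∂ν‖ < 1) :
    ∃ ρ < 1, ∀ᶠ n in atTop, ∀ ψ ∈ K, ‖scaledChar μ α n ψ‖ ≤ ρ := by
  refine hK.induction_on (p := fun s => ∃ ρ < 1, ∀ᶠ n in atTop, ∀ ψ ∈ s,
    ‖scaledChar μ α n ψ‖ ≤ ρ) ⟨0, one_pos, by simp⟩ ?_ ?_ ?_
  · rintro s t hst ⟨ρ, hρ, hev⟩
    exact ⟨ρ, hρ, hev.mono fun n hn ψ hψ => hn ψ (hst hψ)⟩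
  · rintro s t ⟨ρ, hρ, hev⟩ ⟨ρ', hρ', hev'⟩
    refine ⟨max ρ ρ', max_lt hρ hρ', ?_⟩
    filter_upwards [hev, hev'] with n h1 h2 ψ hψ
    rcases hψ with hψ | hψ
    · exact (h1 ψ hψ).trans (le_max_left _ _)
    · exact (h2 ψ hψ).trans (le_max_right _ _)
  · intro ψ hψ
    obtain ⟨U, hU, ρ, hρ, hev⟩ := exists_nhds_norm_scaledChar_le h (hlt ψ hψ)
    exact ⟨U, mem_nhdsWithin_of_mem_nhds hU, ρ, hρ, hev⟩

/-- The two phases agree modulo `2π`, and a multiple of `2π` of modulus less than 1 is 0. -/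
lemma planeWave_eq_imp {θ x x₀ : Fin d → ℝ} (h : planeWave θ x = planeWave θ x₀)
    (hlt : |θ ⬝ᵥ (x - x₀)| < 1) : θ ⬝ᵥ (x - x₀) = 0 := by
  obtain ⟨n, hn⟩ := Complex.exp_eq_exp_iff_exists_int.1 h
  have h1 : (((θ ⬝ᵥ x : ℝ) : ℂ)) = ((θ ⬝ᵥ x₀ + n * (2 * Real.pi) : ℝ) : ℂ) := by
    have : ((θ ⬝ᵥ x : ℝ) : ℂ) * Complex.I =
        ((θ ⬝ᵥ x₀ + n * (2 * Real.pi) : ℝ) : ℂ) * Complex.I := by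
      rw [hn]; push_cast; ring
    exact mul_right_cancel₀ Complex.I_ne_zero this
  have h2 : θ ⬝ᵥ (x - x₀) = n * (2 * Real.pi) := by
    rw [dotProduct_sub]
    have := Complex.ofReal_injective h1
    linarith
  rw [h2] at hlt ⊢
  have hn0 : n = 0 := by
    by_contra hne
    have h3 : (1 : ℝ) ≤ |(n : ℝ)| := by exact_mod_cast Int.one_le_abs hne
    rw [abs_mul, abs_of_pos (by positivity : 0 < 2 * Real.pi)] at hlt
    nlinarith [Real.pi_gt_three]
  simp [hn0]

/-- The characteristic function of a full law has modulus less than `1` near the origin. -/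
lemma IsFullMeasure.exists_norm_lt_one (hν : IsFullMeasure ν) :
    ∃ δ > 0, ∀ ψ : Fin d → ℝ, ψ ≠ 0 → ‖ψ‖ ≤ δ → ‖∫ x, planeWave ψ x ∂ν‖ < 1 := by
  by_contra! hcon
  choose ψ hψ0 hψle hψ using fun m : ℕ => hcon (1 / ((m : ℝ) + 1)) (by positivity)
  have hψlim : Tendsto ψ atTop (𝓝 0) :=
    squeeze_zero_norm hψle tendsto_one_div_add_atTop_nhds_zero_nat
  -- Equality in the triangle inequality: a unimodular function whose mean has modulus at least 1 is
  -- almost everywhere constant.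
  have hae : ∀ᵐ x ∂ν, ∀ m, planeWave (ψ m) x = ⨍ x, planeWave (ψ m) x ∂ν := by
    rw [ae_all_iff]
    intro m
    rcases ae_eq_const_or_norm_integral_lt_of_norm_le_const (μ := ν) (f := planeWave (ψ m)) (C := 1)
      (.of_forall fun x => (norm_planeWave _ x).le) with h | h
    · exact h
    · simp only [probReal_univ, one_mul] at h
      exact absurd h (not_lt.2 (hψ m))
  obtain ⟨x₀, hx₀⟩ := hae.exists
  -- As `ψ m → 0` the constant phases become exact equations `ψ m ⬝ᵥ (x - x₀) = 0`. A limit of the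
  -- normalized directions is normal to a hyperplane carrying `ν`.
  let u : ℕ → Fin d → ℝ := fun m => ‖ψ m‖⁻¹ • ψ m
  have hu : ∀ m, u m ∈ Metric.sphere (0 : Fin d → ℝ) 1 := by
    intro m
    have : ‖ψ m‖ ≠ 0 := norm_ne_zero_iff.2 (hψ0 m)
    simp [u, norm_smul, this]
  obtain ⟨v, hv, φ, hφ, hlim⟩ := (isCompact_sphere (0 : Fin d → ℝ) 1).tendsto_subseq hu
  have hv0 : v ≠ 0 := by
    rintro rfl
    simp at hv
  refine hν v (v ⬝ᵥ x₀) hv0 ?_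
  filter_upwards [hae] with x hx
  have hdot : ∀ w : Fin d → ℝ, Continuous fun θ : Fin d → ℝ => θ ⬝ᵥ w := fun w =>
    continuous_dotProduct_pair.comp (Continuous.prodMk_left w)
  have h1 : ∀ᶠ m in atTop, |ψ m ⬝ᵥ (x - x₀)| < 1 := by
    have := (((hdot (x - x₀)).tendsto 0).comp hψlim).abs
    simp only [zero_dotProduct, abs_zero] at this
    exact this.eventually_lt_const one_pos
  have h2 : ∀ᶠ m in atTop, u (φ m) ⬝ᵥ (x - x₀) = 0 := by
    filter_upwards [hφ.tendsto_atTop.eventually h1] with m hm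
    rw [smul_dotProduct, planeWave_eq_imp ((hx _).trans (hx₀ _).symm) hm, smul_zero]
  have h3 : Tendsto (fun m => u (φ m) ⬝ᵥ (x - x₀)) atTop (𝓝 (v ⬝ᵥ (x - x₀))) :=
    ((hdot (x - x₀)).tendsto v).comp hlim
  have h4 : v ⬝ᵥ (x - x₀) = 0 :=
    tendsto_nhds_unique h3 (tendsto_const_nhds.congr' (h2.mono fun m hm => hm.symm))
  rw [dotProduct_sub] at h4
  linarith

end CharacteristicFunction

/-! ### Decay of the characteristic function near the origin. -/

section Decay

open scoped Topology

variable {d : ℕ} {μ : Measure (Fin d → ℤ)} [IsProbabilityMeasure μ] {ν : Measure (Fin d → ℝ)}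
  [IsProbabilityMeasure ν] {α : Fin d → ℝ}

/-- Every small nonzero `θ` is brought into a fixed shell by a power `n ^ E`. -/
lemma exists_scale (hα : ∀ i, 0 < α i) {δ : ℝ} (hδ : 0 < δ) {θ : Fin d → ℝ} {i : Fin d}
    (hi : θ i ≠ 0) (hmax : ∀ j, (|θ j| / δ) ^ α j ≤ (|θ i| / δ) ^ α i) {N : ℕ}
    (hN : (|θ i| / δ) ^ α i ≤ 1 / ((N : ℝ) + 1)) :
    ∃ n : ℕ, N < n ∧ n * (|θ i| / δ) ^ α i ≤ 1 ∧
      ‖fun j => (n : ℝ) ^ (1 / α j) * θ j‖ ≤ δ ∧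
      δ * (1 / 2) ^ (∑ j, 1 / α j) ≤ ‖fun j => (n : ℝ) ^ (1 / α j) * θ j‖ := by
  set s := (|θ i| / δ) ^ α i with hs
  have hs0 : 0 < s := Real.rpow_pos_of_pos (div_pos (abs_pos.2 hi) hδ) _
  have hNs : ((N : ℝ) + 1) ≤ 1 / s := by
    rw [le_div_iff₀ hs0]
    rwa [le_div_iff₀ (by positivity), mul_comm] at hN
  -- The largest `n` with `n * s ≤ 1`. It also satisfies `n * s ≥ 1 / 2`, which gives the inner
  -- radius of the shell through the dominant coordinate `i`.
  refine ⟨⌊1 / s⌋₊, ?_, ?_, ?_, ?_⟩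
  · exact Nat.lt_of_succ_le (Nat.le_floor (by exact_mod_cast hNs))
  · have := Nat.floor_le (a := 1 / s) (by positivity)
    rwa [le_div_iff₀ hs0] at this
  all_goals
    set n := ⌊1 / s⌋₊ with hn
    have hNn : N + 1 ≤ n := Nat.le_floor (by exact_mod_cast hNs)
    have hn1 : (1 : ℝ) ≤ n := by exact_mod_cast (by omega : 1 ≤ n)
    have hns : n * s ≤ 1 := by
      have := Nat.floor_le (a := 1 / s) (by positivity)
      rwa [le_div_iff₀ hs0] at this
  · refine (pi_norm_le_iff_of_nonneg hδ.le).2 fun j => ?_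
    have hj := hα j
    have h1 : (|θ j| / δ) ≤ ((n : ℝ)⁻¹) ^ (1 / α j) := by
      have h2 : (|θ j| / δ) ^ α j ≤ (n : ℝ)⁻¹ :=
        (hmax j).trans (by rw [← one_div, le_div_iff₀ (by positivity), mul_comm]; exact hns)
      have h3 := Real.rpow_le_rpow (by positivity) h2 (by positivity : 0 ≤ 1 / α j)
      rwa [← Real.rpow_mul (by positivity), mul_one_div_cancel hj.ne', Real.rpow_one] at h3
    rw [Real.inv_rpow (by positivity), div_le_iff₀ hδ, inv_mul_eq_div,
      le_div_iff₀ (by positivity)] at h1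
    rw [Real.norm_eq_abs, abs_mul, abs_of_nonneg (by positivity), mul_comm]
    exact h1
  · refine le_trans ?_ (norm_le_pi_norm (fun j => (n : ℝ) ^ (1 / α j) * θ j) i)
    have hai := hα i
    have h1 : (1 : ℝ) / 2 ≤ n * s := by
      have h2 := Nat.lt_floor_add_one (1 / s)
      rw [div_lt_iff₀ hs0] at h2
      nlinarith
    have h2 : s ^ (1 / α i) = |θ i| / δ := by
      rw [hs, ← Real.rpow_mul (by positivity), mul_one_div_cancel hai.ne', Real.rpow_one]
    have h3 : ((1 : ℝ) / 2) ^ (1 / α i) ≤ (n : ℝ) ^ (1 / α i) * (|θ i| / δ) := by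
      rw [← h2, ← Real.mul_rpow (by positivity) hs0.le]
      exact Real.rpow_le_rpow (by norm_num) h1 (by positivity)
    -- Replacing `1 / α i` by the sum makes the inner radius independent of `i`.
    have h4 : ((1 : ℝ) / 2) ^ (∑ j, 1 / α j) ≤ ((1 : ℝ) / 2) ^ (1 / α i) :=
      Real.rpow_le_rpow_of_exponent_ge (by norm_num) (by norm_num)
        (Finset.single_le_sum (f := fun j => 1 / α j)
          (fun j _ => by have := hα j; positivity) (Finset.mem_univ i))
    rw [Real.norm_eq_abs, abs_mul, abs_of_nonneg (by positivity : 0 ≤ (n : ℝ) ^ (1 / α i))]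
    calc δ * (1 / 2) ^ (∑ j, 1 / α j) ≤ δ * ((n : ℝ) ^ (1 / α i) * (|θ i| / δ)) := by
          gcongr; exact h4.trans h3
      _ = _ := by field_simp

/-- Decay of the characteristic function of a law in the domain of attraction of a full law. -/
lemma exists_norm_stepChar_le (hα : ∀ i, 0 < α i) (hν : IsFullMeasure ν)
    (h : ScaledSumsConverge α μ ν) :
    ∃ b : Fin d → ℝ, (∀ j, 0 < b j) ∧
      ∀ᶠ θ in 𝓝 (0 : Fin d → ℝ), ‖stepChar μ θ‖ ≤ Real.exp (-∑ j, b j * |θ j| ^ α j) := by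
  obtain ⟨δ, hδ, hlt⟩ := hν.exists_norm_lt_one
  have hr0 : 0 < δ * (1 / 2 : ℝ) ^ (∑ j, 1 / α j) := by positivity
  set r := δ * (1 / 2 : ℝ) ^ (∑ j, 1 / α j) with hr
  have hK : IsCompact {ψ : Fin d → ℝ | ‖ψ‖ ≤ δ ∧ r ≤ ‖ψ‖} := by
    have h1 : {ψ : Fin d → ℝ | ‖ψ‖ ≤ δ ∧ r ≤ ‖ψ‖} =
        Metric.closedBall 0 δ ∩ {ψ | r ≤ ‖ψ‖} := by
      ext ψ; simp
    rw [h1]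
    exact (isCompact_closedBall _ _).inter_right (isClosed_le continuous_const continuous_norm)
  obtain ⟨ρ', hρ', hev⟩ := exists_norm_scaledChar_le_of_isCompact h hK (by
    rintro ψ ⟨h1, h2⟩
    exact hlt ψ (norm_pos_iff.1 (hr0.trans_le h2)) h1)
  obtain ⟨N, hN⟩ := eventually_atTop.1 hev
  -- The bound `ρ'` need not be positive; the maximum makes the logarithm of `ρ` meaningful.
  set ρ := max ρ' (1 / 2) with hρdef
  have hρ0 : 0 < ρ := lt_max_of_lt_right (by norm_num)
  have hρ1 : ρ < 1 := max_lt hρ' (by norm_num)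
  set c := -Real.log ρ with hc
  have hc0 : 0 < c := neg_pos.2 (Real.log_neg hρ0 hρ1)
  -- The estimate comes out as `exp (-c s)` with `s` the maximum of `(|θ j| / δ) ^ α j`. The factor
  -- `1 / d` bounds this maximum below by the average.
  refine ⟨fun j => c / d / δ ^ α j, fun j => ?_, ?_⟩
  · have : (0 : ℝ) < d := by exact_mod_cast j.pos
    positivity
  have hsmall : ∀ᶠ θ in 𝓝 (0 : Fin d → ℝ), ∀ i, (|θ i| / δ) ^ α i < 1 / ((N : ℝ) + 1) := by
    rw [eventually_all]
    intro i
    have hcont : Continuous fun θ : Fin d → ℝ => (|θ i| / δ) ^ α i :=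
      Continuous.rpow_const (by fun_prop) fun _ => Or.inr (hα i).le
    have h0 := hcont.tendsto 0
    simp only [Pi.zero_apply, abs_zero, zero_div, Real.zero_rpow (hα i).ne'] at h0
    exact h0.eventually_lt_const (by positivity)
  filter_upwards [hsmall] with θ hθ
  rcases eq_or_ne θ 0 with rfl | hne
  · have : ∀ j, (0 : ℝ) ^ α j = 0 := fun j => Real.zero_rpow (hα j).ne'
    simpa [this] using norm_stepChar_le_one (μ := μ) 0
  obtain ⟨i₀, hi₀⟩ := Function.ne_iff.1 hne
  have : Nonempty (Fin d) := ⟨i₀⟩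
  obtain ⟨i, hmax⟩ := Finite.exists_max fun j => (|θ j| / δ) ^ α j
  have hi : θ i ≠ 0 := by
    intro hi
    have h1 := hmax i₀
    rw [hi, abs_zero, zero_div, Real.zero_rpow (hα i).ne'] at h1
    exact absurd h1 (not_le.2 (Real.rpow_pos_of_pos (div_pos (abs_pos.2 hi₀) hδ) _))
  obtain ⟨n, hNn, hns, hle, hge⟩ := exists_scale hα hδ hi hmax (hθ i).le
  have hn0 : (0 : ℝ) < n := by exact_mod_cast (by omega : 0 < n)
  have h1 : ‖stepChar μ θ‖ ^ n ≤ ρ := by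
    have h2 := hN n hNn.le (fun j => (n : ℝ) ^ (1 / α j) * θ j) ⟨hle, hge⟩
    rw [scaledChar_eq, norm_pow] at h2
    have h3 : (fun j => (n : ℝ) ^ (-(1 / α j)) * ((n : ℝ) ^ (1 / α j) * θ j)) = θ := by
      ext j
      rw [← mul_assoc, ← Real.rpow_add hn0, neg_add_cancel, Real.rpow_zero, one_mul]
    rw [h3] at h2
    exact h2.trans (le_max_left _ _)
  set s := (|θ i| / δ) ^ α i with hs
  -- An `n`-th root of the previous bound, using `ρ = exp (-c)` and `n * s ≤ 1`.
  have h4 : ‖stepChar μ θ‖ ≤ Real.exp (-(c * s)) := by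
    by_contra hcon
    have h5 := pow_lt_pow_left₀ (not_le.1 hcon) (Real.exp_nonneg _) (show n ≠ 0 by omega)
    rw [← Real.exp_nat_mul] at h5
    have h6 : ρ ≤ Real.exp (n * -(c * s)) := by
      calc ρ = Real.exp (-c) := by rw [hc, neg_neg, Real.exp_log hρ0]
        _ ≤ _ := Real.exp_le_exp.2 (by nlinarith)
    linarith
  refine h4.trans (Real.exp_le_exp.2 (neg_le_neg ?_))
  have hd0 : (0 : ℝ) < d := by exact_mod_cast i.pos
  calc ∑ j, c / d / δ ^ α j * |θ j| ^ α j = ∑ j, c / d * (|θ j| / δ) ^ α j := by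
        refine Finset.sum_congr rfl fun j _ => ?_
        rw [Real.div_rpow (abs_nonneg _) hδ.le]
        ring
    _ ≤ ∑ _j : Fin d, c / d * s := Finset.sum_le_sum fun j _ => by
        have := hmax j
        gcongr
    _ = c * s := by
        rw [Finset.sum_const, Finset.card_univ, Fintype.card_fin, nsmul_eq_mul]
        field_simp

end Decay

/-! ### Point masses bounded by the characteristic function near 0. -/

section Concentration

open scoped Topology ComplexConjugate

lemma measurable_stepChar {d : ℕ} {μ : Measure (Fin d → ℤ)} [SFinite μ] :
    Measurable (stepChar μ) := by
  have h : StronglyMeasurable fun q : (Fin d → ℝ) × (Fin d → ℤ) => planeWave q.1 (intVec q.2) :=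
    (continuous_planeWave_pair.measurable.comp (measurable_fst.prodMk
      ((Measurable.of_discrete (f := intVec (d := d))).comp measurable_snd))).stronglyMeasurable
  exact h.integral_prod_right.measurable

variable {d : ℕ} {μ : Measure (Fin d → ℤ)} [IsProbabilityMeasure μ] {α : Fin d → ℝ}

lemma integral_exp_neg_mul_abs_rpow {p b : ℝ} (hp : 0 < p) (hb : 0 < b) :
    ∫ x : ℝ, Real.exp (-(b * |x| ^ p)) = 2 * (b ^ (-1 / p) * Real.Gamma (1 / p + 1)) := by
  rw [integral_comp_abs (f := fun x => Real.exp (-(b * x ^ p))),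
    ← integral_exp_neg_mul_rpow hp hb]
  simp only [neg_mul]

lemma integral_exp_neg_sum (hα : ∀ i, 0 < α i) {b : Fin d → ℝ} (hb : ∀ j, 0 < b j) :
    ∫ θ : Fin d → ℝ, Real.exp (-∑ j, b j * |θ j| ^ α j) =
      ∏ j, 2 * (b j ^ (-1 / α j) * Real.Gamma (1 / α j + 1)) := by
  simp only [← integral_exp_neg_mul_abs_rpow (hα _) (hb _)]
  rw [← integral_fintype_prod_volume_eq_prod (f := fun j x => Real.exp (-(b j * |x| ^ α j)))]
  simp only [← Real.exp_sum, Finset.sum_neg_distrib]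

lemma integrable_exp_neg_sum (hα : ∀ i, 0 < α i) {b : Fin d → ℝ} (hb : ∀ j, 0 < b j) :
    Integrable fun θ : Fin d → ℝ => Real.exp (-∑ j, b j * |θ j| ^ α j) := by
  refine .of_integral_ne_zero ?_
  rw [integral_exp_neg_sum hα hb]
  refine (Finset.prod_pos fun j _ => ?_).ne'
  have h1 := hα j
  have h2 := hb j
  have h3 : 0 < Real.Gamma (1 / α j + 1) := Real.Gamma_pos_of_pos (by positivity)
  positivity

lemma planeWave_sub_left (θ θ' x : Fin d → ℝ) :
    planeWave (θ - θ') x = planeWave θ x * conj (planeWave θ' x) := by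
  rw [planeWave, planeWave, planeWave, ← Complex.exp_conj, ← Complex.exp_add, sub_dotProduct]
  congr 1
  simp
  ring

lemma planeWave_sub_right (θ x y : Fin d → ℝ) :
    planeWave θ (x - y) = planeWave θ x * conj (planeWave θ y) := by
  rw [planeWave, planeWave, planeWave, ← Complex.exp_conj, ← Complex.exp_add, dotProduct_sub]
  congr 1
  simp
  ring

lemma measurable_planeWave_sub {Ω : Type*} [MeasurableSpace Ω] {Y : Ω → Fin d → ℝ}
    (hY : Measurable Y) : Measurable fun q : Ω × ((Fin d → ℝ) × (Fin d → ℝ)) =>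
      planeWave (q.2.1 - q.2.2) (Y q.1) := by
  unfold planeWave dotProduct
  fun_prop

/-- Averaging over differences produces a nonnegative function of `x` that equals the squared total
mass at 0, so it dominates a multiple of the indicator of 0. -/
lemma integral_planeWave_sub (m : Measure (Fin d → ℝ)) [IsFiniteMeasure m] (x : Fin d → ℝ) :
    ∫ p, planeWave (p.1 - p.2) x ∂m.prod m = ((‖∫ θ, planeWave θ x ∂m‖ ^ 2 : ℝ) : ℂ) := by
  simp only [planeWave_sub_left]
  rw [integral_prod_mul (fun θ => planeWave θ x) (fun θ => conj (planeWave θ x)),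
    integral_conj, Complex.mul_conj, Complex.normSq_eq_norm_sq]

/-- A bound for the mass at the origin by the characteristic function near the origin. -/
lemma measureReal_univ_mul_le {Ω : Type*} [MeasurableSpace Ω] (P : Measure Ω)
    [IsFiniteMeasure P] {Y : Ω → Fin d → ℝ} (hY : Measurable Y) (m : Measure (Fin d → ℝ))
    [IsFiniteMeasure m] :
    m.real Set.univ ^ 2 * P.real {ω | Y ω = 0} ≤
      ∫ p, ‖∫ ω, planeWave (p.1 - p.2) (Y ω) ∂P‖ ∂m.prod m := by
  have hint : Integrable (Function.uncurry fun (ω : Ω)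
      (p : (Fin d → ℝ) × (Fin d → ℝ)) => planeWave (p.1 - p.2) (Y ω)) (P.prod (m.prod m)) :=
    .of_bound (measurable_planeWave_sub hY).aestronglyMeasurable 1 (.of_forall fun _ => (norm_planeWave _ _).le)
  have hHint : Integrable (fun ω => ‖∫ θ, planeWave θ (Y ω) ∂m‖ ^ 2) P := by
    have h2 := hint.integral_prod_left.norm
    simp only [Function.uncurry_apply_pair, integral_planeWave_sub, Complex.norm_real, norm_pow,
      norm_norm] at h2
    exact h2
  have h1 : m.real Set.univ ^ 2 * P.real {ω | Y ω = 0} ≤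
      ∫ ω, ‖∫ θ, planeWave θ (Y ω) ∂m‖ ^ 2 ∂P := by
    have hsub : {ω | Y ω = 0} ⊆ {ω | m.real Set.univ ^ 2 ≤ ‖∫ θ, planeWave θ (Y ω) ∂m‖ ^ 2} := by
      intro ω hω
      have hω : Y ω = 0 := hω
      simp [hω, planeWave]
    have hmark := mul_meas_ge_le_integral_of_nonneg
      (Eventually.of_forall fun ω => by positivity) hHint (m.real Set.univ ^ 2)
    exact (mul_le_mul_of_nonneg_left (measureReal_mono hsub) (by positivity)).trans hmark
  have h3 : ∫ ω, ‖∫ θ, planeWave θ (Y ω) ∂m‖ ^ 2 ∂P =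
      ‖∫ ω, ∫ p, planeWave (p.1 - p.2) (Y ω) ∂m.prod m ∂P‖ := by
    simp only [integral_planeWave_sub]
    rw [integral_complex_ofReal, Complex.norm_real, Real.norm_eq_abs, abs_of_nonneg]
    exact integral_nonneg fun ω => by positivity
  rw [h3, integral_integral_swap hint] at h1
  exact h1.trans (norm_integral_le_integral_norm _)

/-- Recentring the sum at `v` multiplies its characteristic function by a unimodular factor, so the
bound is uniform in `v`. -/
lemma measureReal_univ_mul_sumMass_le (n : ℕ) (v : Fin d → ℤ) (m : Measure (Fin d → ℝ))
    [IsFiniteMeasure m] :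
    m.real Set.univ ^ 2 * (sumMass μ n v).toReal ≤
      ∫ p, ‖stepChar μ (p.1 - p.2)‖ ^ n ∂m.prod m := by
  have hmint : Measurable (intVec (d := d)) := Measurable.of_discrete
  have h := measureReal_univ_mul_le (Measure.infinitePi (fun _ : ℕ => μ))
    (Y := fun a => intVec (stepSum n a) - intVec v)
    ((hmint.comp (measurable_stepSum n)).sub_const _) m
  have h1 : ∀ θ : Fin d → ℝ, ‖∫ a, planeWave θ (intVec (stepSum n a) - intVec v)
      ∂Measure.infinitePi (fun _ : ℕ => μ)‖ = ‖stepChar μ θ‖ ^ n := by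
    intro θ
    simp only [planeWave_sub_right]
    rw [integral_mul_const, integral_planeWave_stepSum, norm_mul, norm_pow, RCLike.norm_conj,
      norm_planeWave, mul_one]
  have h2 : {a : ℕ → Fin d → ℤ | intVec (stepSum n a) - intVec v = 0} =
      {a | stepSum n a = v} := by
    ext a
    simp only [Set.mem_ofPred_eq, sub_eq_zero, intVec, funext_iff, Int.cast_inj]
  simp only [h1] at h
  rw [h2] at h
  exact h

/-- The mass of points under the law of a sum of `n` steps is of order `n ^ (-∑ 1 / α j)`. -/
lemma exists_sumMass_le (hα : ∀ i, 0 < α i) {b : Fin d → ℝ} (hb : ∀ j, 0 < b j)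
    (hdecay : ∀ᶠ θ in 𝓝 (0 : Fin d → ℝ),
      ‖stepChar μ θ‖ ≤ Real.exp (-∑ j, b j * |θ j| ^ α j)) :
    ∃ C : ℝ, 0 < C ∧ ∀ n : ℕ, 1 ≤ n → ∀ v,
      (sumMass μ n v).toReal ≤ C * (n : ℝ) ^ (-∑ j, 1 / α j) := by
  obtain ⟨δ, hδ, hδb⟩ := Metric.eventually_nhds_iff_ball.1 hdecay
  -- Differences of points of this cube have sup norm at most `δ / 2`, inside the ball where the
  -- decay is known.
  let S : Set (Fin d → ℝ) := Set.Icc 0 (fun _ => δ / 2)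
  let m : Measure (Fin d → ℝ) := volume.restrict S
  have hSm : MeasurableSet S := measurableSet_Icc
  have hvol : volume S = ENNReal.ofReal ((δ / 2) ^ d) := by
    simp only [S, Real.volume_Icc_pi]
    simp [ENNReal.ofReal_pow (by positivity : 0 ≤ δ / 2)]
  have : IsFiniteMeasure m := ⟨by
    rw [Measure.restrict_apply_univ, hvol]; exact ENNReal.ofReal_lt_top⟩
  set M := m.real Set.univ with hM
  have hM0 : 0 < M := by
    rw [hM, measureReal_def, Measure.restrict_apply_univ, hvol,
      ENNReal.toReal_ofReal (by positivity)]
    positivity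
  let D : ℝ := ∏ j, 2 * (b j ^ (-1 / α j) * Real.Gamma (1 / α j + 1))
  have hD : 0 < D := Finset.prod_pos fun j _ => by
    have h1 := hα j
    have h2 := hb j
    have h3 : 0 < Real.Gamma (1 / α j + 1) := Real.Gamma_pos_of_pos (by positivity)
    positivity
  -- Integrating out one of the two variables costs one factor `M`, which cancels one of the two on
  -- the left; the other remains in the denominator.
  refine ⟨D / M, by positivity, fun n hn v => ?_⟩
  have hn0 : (0 : ℝ) < n := by exact_mod_cast hn
  let F : (Fin d → ℝ) → ℝ := fun θ => Real.exp (-∑ j, (n * b j) * |θ j| ^ α j)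
  have hnb : ∀ j, 0 < n * b j := fun j => mul_pos hn0 (hb j)
  have hF : Integrable F := integrable_exp_neg_sum hα hnb
  have hFint : ∫ θ, F θ = D * (n : ℝ) ^ (-∑ j, 1 / α j) := by
    simp only [F, D]
    rw [integral_exp_neg_sum hα hnb, ← Finset.sum_neg_distrib, Real.rpow_sum_of_pos hn0,
      ← Finset.prod_mul_distrib]
    refine Finset.prod_congr rfl fun j _ => ?_
    rw [Real.mul_rpow hn0.le (hb j).le, neg_div]
    ring
  have hle : ∀ θ' ∈ S, ∀ θ ∈ S, ‖stepChar μ (θ - θ')‖ ^ n ≤ F (θ - θ') := by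
    intro θ' hθ' θ hθ
    have hball : θ - θ' ∈ Metric.ball (0 : Fin d → ℝ) δ := by
      rw [mem_ball_zero_iff]
      refine (pi_norm_lt_iff hδ).2 fun j => ?_
      have h1 := hθ.1 j
      have h2 := hθ.2 j
      have h3 := hθ'.1 j
      have h4 := hθ'.2 j
      simp only [Pi.zero_apply] at h1 h3
      rw [Real.norm_eq_abs, Pi.sub_apply, abs_lt]
      constructor <;> linarith
    refine (pow_le_pow_left₀ (norm_nonneg _) (hδb _ hball) n).trans (le_of_eq ?_)
    rw [← Real.exp_nat_mul, mul_neg, Finset.mul_sum]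
    simp only [F, mul_assoc]
  have hcharint : Integrable (fun p : (Fin d → ℝ) × (Fin d → ℝ) =>
      ‖stepChar μ (p.1 - p.2)‖ ^ n) (m.prod m) := by
    refine .of_bound (((measurable_stepChar.comp
      (measurable_fst.sub measurable_snd)).norm.pow_const n).aestronglyMeasurable) 1
      (.of_forall fun p => ?_)
    rw [Real.norm_eq_abs, abs_of_nonneg (by positivity)]
    exact pow_le_one₀ (norm_nonneg _) (norm_stepChar_le_one _)
  have hI : ∫ p, ‖stepChar μ (p.1 - p.2)‖ ^ n ∂m.prod m ≤ M * ∫ θ, F θ := by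
    rw [integral_prod_symm _ hcharint]
    have hinner : ∀ᵐ θ' ∂m, ∫ θ, ‖stepChar μ (θ - θ')‖ ^ n ∂m ≤ ∫ θ, F θ := by
      filter_upwards [ae_restrict_mem hSm] with θ' hθ'
      calc ∫ θ, ‖stepChar μ (θ - θ')‖ ^ n ∂m ≤ ∫ θ, F (θ - θ') ∂m := by
            refine integral_mono_of_nonneg (.of_forall fun _ => by positivity)
              (hF.comp_sub_right θ').integrableOn ?_
            filter_upwards [ae_restrict_mem hSm] with θ hθ
            exact hle θ' hθ' θ hθ
        _ ≤ ∫ θ, F (θ - θ') :=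
            setIntegral_le_integral (hF.comp_sub_right θ')
              (.of_forall fun _ => (Real.exp_nonneg _))
        _ = ∫ θ, F θ := integral_sub_right_eq_self F θ'
    calc _ ≤ ∫ _θ' : Fin d → ℝ, (∫ θ, F θ) ∂m :=
          integral_mono_ae hcharint.integral_prod_right (integrable_const _) hinner
      _ = _ := by rw [integral_const, smul_eq_mul]
  have hmain := (measureReal_univ_mul_sumMass_le (μ := μ) n v m).trans hI
  rw [← hM, hFint] at hmain
  have h5 : M * (sumMass μ n v).toReal ≤ D * (n : ℝ) ^ (-∑ j, 1 / α j) := by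
    refine le_of_mul_le_mul_left ?_ hM0
    calc _ = M ^ 2 * (sumMass μ n v).toReal := by ring
      _ ≤ _ := hmain
  rw [div_mul_eq_mul_div, le_div_iff₀ hM0, mul_comm]
  exact h5

end Concentration

/-! ### Infinitely many components when `∑ 1 / α j > 2`. -/

section Transience

open scoped Topology

variable {d : ℕ} {μ : Measure (Fin d → ℤ)} [IsProbabilityMeasure μ]

lemma tsum_sumMass_le_one (k : ℕ) : ∑' v, sumMass μ k v ≤ 1 := by
  calc ∑' v, sumMass μ k v
      = Measure.infinitePi (fun _ : ℕ => μ) (⋃ v, {a | stepSum k a = v}) := by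
        refine (measure_iUnion (fun v v' hv => ?_) fun v => measurableSet_stepSum_eq k v).symm
        rw [Function.onFun, Set.disjoint_left]
        exact fun a h1 h2 => hv (h1.symm.trans h2)
    _ ≤ 1 := prob_le_one

lemma sumMass_le_one (k : ℕ) (v : Fin d → ℤ) : sumMass μ k v ≤ 1 := prob_le_one

lemma twoStepSequences_sub_le_left {k j : ℕ} {B : ENNReal} (hB : ∀ v, sumMass μ k v ≤ B)
    (w : Fin d → ℤ) : twoStepSequences μ {p | stepSum k p.1 - stepSum j p.2 = w} ≤ B := by
  rw [twoStepSequences_sub_eq]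
  calc _ ≤ ∑' v, B * sumMass μ j v := ENNReal.tsum_le_tsum fun v => by gcongr; exact hB _
    _ ≤ B := by
        rw [ENNReal.tsum_mul_left]
        exact mul_le_of_le_one_right' (tsum_sumMass_le_one j)

lemma twoStepSequences_sub_le_right {k j : ℕ} {B : ENNReal} (hB : ∀ v, sumMass μ j v ≤ B)
    (w : Fin d → ℤ) : twoStepSequences μ {p | stepSum k p.1 - stepSum j p.2 = w} ≤ B := by
  rw [twoStepSequences_sub_eq]
  calc _ ≤ ∑' v, sumMass μ k (v + w) * B := ENNReal.tsum_le_tsum fun v => by gcongr; exact hB _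
    _ ≤ B := by
        rw [ENNReal.tsum_mul_right]
        exact mul_le_of_le_one_left'
          (((Equiv.addRight w).tsum_eq (sumMass μ k)).trans_le (tsum_sumMass_le_one k))

/-- Passing to `n + 1` includes time 0; the factor `2 ^ q` comes from `n + 1 ≤ 2 n`. -/
lemma exists_sumMass_le_ofReal {q C : ℝ} (hq : 0 < q) (hC : 0 < C)
    (h : ∀ n : ℕ, 1 ≤ n → ∀ v, (sumMass μ n v).toReal ≤ C * (n : ℝ) ^ (-q)) :
    ∃ K : ℝ, 0 < K ∧ ∀ n v, sumMass μ n v ≤ ENNReal.ofReal (K * ((n : ℝ) + 1) ^ (-q)) := by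
  refine ⟨max 1 (C * 2 ^ q), lt_max_of_lt_left one_pos, fun n v => ?_⟩
  rcases Nat.eq_zero_or_pos n with rfl | hn
  · refine (sumMass_le_one 0 v).trans ?_
    simp
  · have hn' : (1 : ℝ) ≤ n := by exact_mod_cast hn
    rw [← ENNReal.ofReal_toReal (sumMass_ne_top μ n v)]
    refine ENNReal.ofReal_le_ofReal ((h n hn v).trans ?_)
    have h1 : (n : ℝ) ^ (-q) ≤ 2 ^ q * ((n : ℝ) + 1) ^ (-q) := by
      have h2 : (2 * (n : ℝ)) ^ (-q) ≤ ((n : ℝ) + 1) ^ (-q) :=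
        Real.rpow_le_rpow_of_nonpos (by positivity) (by linarith) (by linarith)
      rw [Real.mul_rpow (by norm_num) (by positivity)] at h2
      calc (n : ℝ) ^ (-q) = 2 ^ q * (2 ^ (-q) * (n : ℝ) ^ (-q)) := by
            rw [← mul_assoc, ← Real.rpow_add (by norm_num), add_neg_cancel, Real.rpow_zero, one_mul]
        _ ≤ _ := by gcongr
    calc C * (n : ℝ) ^ (-q) ≤ C * (2 ^ q * ((n : ℝ) + 1) ^ (-q)) := by gcongr
      _ = C * 2 ^ q * ((n : ℝ) + 1) ^ (-q) := by ring
      _ ≤ _ := by gcongr; exact le_max_right _ _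

/-- Using the later time gives `max(k + 1, j + 1) ^ (-q)`, which is at most the product of the two
powers with exponent `-q / 2`. The product form is summable as soon as `q / 2 > 1`. -/
lemma twoStepSequences_sub_toReal_le {q K : ℝ} (hq : 0 < q) (hK : 0 < K)
    (h : ∀ n v, sumMass μ n v ≤ ENNReal.ofReal (K * ((n : ℝ) + 1) ^ (-q))) (k j : ℕ)
    (w : Fin d → ℤ) :
    (twoStepSequences μ {p | stepSum k p.1 - stepSum j p.2 = w}).toReal ≤
      K * (((k : ℝ) + 1) ^ (-(q / 2)) * ((j : ℝ) + 1) ^ (-(q / 2))) := by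
  have hsplit : ∀ x : ℝ, 0 < x → x ^ (-q) = x ^ (-(q / 2)) * x ^ (-(q / 2)) := fun x hx => by
    rw [← Real.rpow_add hx]; congr 1; ring
  refine ENNReal.toReal_le_of_le_ofReal (by positivity) ?_
  rcases le_total k j with hkj | hkj
  · refine (twoStepSequences_sub_le_right (h j) w).trans (ENNReal.ofReal_le_ofReal ?_)
    rw [hsplit _ (by positivity)]
    have h1 : ((j : ℝ) + 1) ^ (-(q / 2)) ≤ ((k : ℝ) + 1) ^ (-(q / 2)) :=
      Real.rpow_le_rpow_of_nonpos (by positivity) (by gcongr) (by linarith)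
    gcongr
  · refine (twoStepSequences_sub_le_left (h k) w).trans (ENNReal.ofReal_le_ofReal ?_)
    rw [hsplit _ (by positivity)]
    have h1 : ((k : ℝ) + 1) ^ (-(q / 2)) ≤ ((j : ℝ) + 1) ^ (-(q / 2)) :=
      Real.rpow_le_rpow_of_nonpos (by positivity) (by gcongr) (by linarith)
    gcongr

lemma summable_rpow_prod {q : ℝ} (hq : 2 < q) : Summable fun p : ℕ × ℕ =>
    ((p.1 : ℝ) + 1) ^ (-(q / 2)) * ((p.2 : ℝ) + 1) ^ (-(q / 2)) := by
  have h : Summable fun n : ℕ => ((n : ℝ) + 1) ^ (-(q / 2)) := by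
    have := (summable_nat_add_iff 1).2 (Real.summable_nat_rpow.2 (by linarith : -(q / 2) < -1))
    simpa using this
  exact h.mul_of_nonneg h (fun n => by positivity) (fun n => by positivity)

/-- The diagonal vector with all coordinates equal to `t`. -/
def diagVec (d : ℕ) (t : ℕ) : Fin d → ℤ := fun _ => t

/-- For distinct `t` the events are disjoint, so their probabilities are summable. -/
lemma tendsto_twoStepSequences_diagVec (hd : 1 ≤ d) (k j : ℕ) :
    Tendsto (fun t => (twoStepSequences μ
      {p | stepSum k p.1 - stepSum j p.2 = diagVec d t}).toReal) atTop (𝓝 0) := by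
  have h : ∑' t, twoStepSequences μ {p | stepSum k p.1 - stepSum j p.2 = diagVec d t} ≤ 1 := by
    calc _ = twoStepSequences μ (⋃ t, {p | stepSum k p.1 - stepSum j p.2 = diagVec d t}) := by
          refine (measure_iUnion (fun t t' ht => ?_) fun t => measurableSet_sub_eq k j _).symm
          rw [Function.onFun, Set.disjoint_left]
          intro p h1 h2
          have h3 := congrFun (h1.symm.trans h2 : diagVec d t = diagVec d t') ⟨0, hd⟩
          exact ht (by simpa [diagVec] using h3)
      _ ≤ 1 := prob_le_one
  have h1 := ENNReal.tendsto_atTop_zero_of_tsum_ne_top (h.trans_lt ENNReal.one_lt_top).ne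
  exact (ENNReal.tendsto_toReal ENNReal.zero_ne_top).comp h1

/-- If the point masses of the sums decay faster than `n ^ (-2)`, then distant independent walks
have few common positions in expectation. -/
lemma tendsto_tsum_twoStepSequences_diagVec (hd : 1 ≤ d) {q C : ℝ} (hq : 2 < q) (hC : 0 < C)
    (h : ∀ n : ℕ, 1 ≤ n → ∀ v, (sumMass μ n v).toReal ≤ C * (n : ℝ) ^ (-q)) :
    Tendsto (fun t => ∑' r : ℕ × ℕ, twoStepSequences μ
      {p | stepSum r.1 p.1 - stepSum r.2 p.2 = diagVec d t}) atTop (𝓝 0) := by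
  obtain ⟨K, hK, hle⟩ := exists_sumMass_le_ofReal (by linarith : 0 < q) hC h
  have hb := (summable_rpow_prod hq).mul_left K
  have hbound : ∀ t (r : ℕ × ℕ), (twoStepSequences μ
      {p | stepSum r.1 p.1 - stepSum r.2 p.2 = diagVec d t}).toReal ≤
      K * (((r.1 : ℝ) + 1) ^ (-(q / 2)) * ((r.2 : ℝ) + 1) ^ (-(q / 2))) := fun t r =>
    twoStepSequences_sub_toReal_le (by linarith) hK hle r.1 r.2 _
  have h1 := tendsto_tsum_of_dominated_convergence (𝓕 := atTop) (g := fun _ : ℕ × ℕ => (0 : ℝ))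
    (f := fun t (r : ℕ × ℕ) => (twoStepSequences μ
      {p | stepSum r.1 p.1 - stepSum r.2 p.2 = diagVec d t}).toReal) hb
    (fun r => tendsto_twoStepSequences_diagVec hd r.1 r.2)
    (.of_forall fun t r => by
      rw [Real.norm_eq_abs, abs_of_nonneg ENNReal.toReal_nonneg]
      exact hbound t r)
  have h2 := ENNReal.tendsto_ofReal h1
  rw [tsum_zero, ENNReal.ofReal_zero] at h2
  refine h2.congr fun t => ?_
  rw [ENNReal.ofReal_tsum_of_nonneg (fun _ => ENNReal.toReal_nonneg)
    (.of_nonneg_of_le (fun _ => ENNReal.toReal_nonneg) (hbound t) hb)]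
  exact tsum_congr fun r => ENNReal.ofReal_toReal (measure_ne_top _ _)

lemma measure_linesMeet_diagVec_le (hd : 1 ≤ d) (hμ : IsCarriedByPositive μ) {s t : ℕ}
    (hst : s ≤ t) :
    Measure.infinitePi (fun _ : Fin d → ℤ => μ) {z | LinesMeet z (diagVec d t) (diagVec d s)} ≤
      ∑' r : ℕ × ℕ, twoStepSequences μ
        {p | stepSum r.1 p.1 - stepSum r.2 p.2 = diagVec d (t - s)} := by
  refine (measure_linesMeet_le hd hμ _ _).trans (ENNReal.tsum_le_tsum fun r =>
    measure_mono fun p hp => ?_)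
  have hp : diagVec d t - stepSum r.1 p.1 = diagVec d s - stepSum r.2 p.2 := hp
  have h1 : diagVec d (t - s) = diagVec d t - diagVec d s := by
    funext c
    simp [diagVec, Nat.cast_sub hst]
  change stepSum r.1 p.1 - stepSum r.2 p.2 = diagVec d (t - s)
  rw [h1, sub_eq_sub_iff_add_eq_add]
  rw [sub_eq_sub_iff_add_eq_add] at hp
  rw [hp, add_comm]

/-- If distant independent walks have few common positions in expectation, then the graph has
almost surely infinitely many components. -/
theorem ae_infinite_digraphComponent (hd : 1 ≤ d) (hμ : IsCarriedByPositive μ)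
    (h : Tendsto (fun t => ∑' r : ℕ × ℕ, twoStepSequences μ
      {p | stepSum r.1 p.1 - stepSum r.2 p.2 = diagVec d t}) atTop (𝓝 0)) :
    ∀ᵐ z ∂Measure.infinitePi (fun _ : Fin d → ℤ => μ),
      Infinite (digraphComponent (ancestorDigraph z)) := by
  set m : ℕ → ENNReal := fun t => ∑' r : ℕ × ℕ, twoStepSequences μ
      {p | stepSum r.1 p.1 - stepSum r.2 p.2 = diagVec d t} with hm
  -- The factor `j` pays for the union bound over the `j` earlier sites.
  have hT : ∀ j : ℕ, ∃ T, ∀ t ≥ T, j * m t ≤ (1 / 2) ^ j := by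
    intro j
    have h1 := ENNReal.Tendsto.const_mul h (Or.inr (ENNReal.natCast_ne_top j))
    rw [mul_zero] at h1
    exact eventually_atTop.1 (h1.eventually_le_const (by
      exact ENNReal.pow_pos (by simp) j))
  choose T hT using hT
  -- Partial sums make `a j` exceed every earlier `a i` by at least `T j`.
  let a : ℕ → ℕ := fun j => ∑ i ∈ Finset.range (j + 1), T i
  have ha : ∀ i j, i < j → a i + T j ≤ a j := by
    intro i j hij
    simp only [a]
    rw [Finset.sum_range_succ _ j]
    gcongr
    omega
  let bad : ℕ → Set ((Fin d → ℤ) → (Fin d → ℤ)) := fun j =>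
    ⋃ i ∈ Finset.range j, {z | LinesMeet z (diagVec d (a j)) (diagVec d (a i))}
  have hbad : ∀ j, Measure.infinitePi (fun _ : Fin d → ℤ => μ) (bad j) ≤ (1 / 2) ^ j := by
    intro j
    rcases Nat.eq_zero_or_pos j with rfl | hj
    · simp [bad]
    calc Measure.infinitePi (fun _ : Fin d → ℤ => μ) (bad j)
        ≤ ∑ i ∈ Finset.range j, Measure.infinitePi (fun _ : Fin d → ℤ => μ)
          {z | LinesMeet z (diagVec d (a j)) (diagVec d (a i))} := measure_biUnion_finset_le _ _
      _ ≤ ∑ _i ∈ Finset.range j, (1 / 2) ^ j / (j : ENNReal) := by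
          refine Finset.sum_le_sum fun i hi => ?_
          have hij := ha i j (Finset.mem_range.1 hi)
          refine (measure_linesMeet_diagVec_le hd hμ (by omega)).trans ?_
          rw [ENNReal.le_div_iff_mul_le (Or.inl (by exact_mod_cast hj.ne'))
            (Or.inl (ENNReal.natCast_ne_top j)), mul_comm]
          exact hT j _ (by omega)
      _ = (1 / 2) ^ j := by
          rw [Finset.sum_const, Finset.card_range, nsmul_eq_mul]
          exact ENNReal.mul_div_cancel (by exact_mod_cast hj.ne') (ENNReal.natCast_ne_top j)
  have hsum : ∑' j, Measure.infinitePi (fun _ : Fin d → ℤ => μ) (bad j) ≠ ⊤ := by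
    refine ((ENNReal.tsum_le_tsum hbad).trans_lt ?_).ne
    rw [ENNReal.tsum_geometric, ENNReal.inv_lt_top, tsub_pos_iff_lt]
    simp
  filter_upwards [ae_eventually_notMem hsum] with z hz
  obtain ⟨J, hJ⟩ := eventually_atTop.1 hz
  have hne : ∀ i j, J ≤ i → i < j → ¬ LinesMeet z (diagVec d (a j)) (diagVec d (a i)) := by
    intro i j hi hij hmeet
    refine hJ j (by omega) ?_
    simp only [bad, Set.mem_iUnion]
    exact ⟨i, Finset.mem_range.2 hij, hmeet⟩
  refine Infinite.of_injective (fun n : ℕ =>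
    (ancestorDigraph z).toSimpleGraphInclusive.connectedComponentMk (diagVec d (a (J + n)))) ?_
  intro n n' hnn
  have hmeet := reachable_iff_linesMeet.1 (SimpleGraph.ConnectedComponent.exact hnn)
  by_contra hcon
  rcases lt_or_gt_of_ne hcon with hlt | hlt
  · exact hne (J + n) (J + n') (by omega) (by omega) ((linesMeet_equivalence z).symm hmeet)
  · exact hne (J + n') (J + n) (by omega) (by omega) hmeet

end Transience

/-! ### The dichotomy. -/

theorem mainTheorem6 {d : ℕ} (hd : 1 ≤ d)
    (α : Fin d → ℝ) (hα : ∀ i, 0 < α i)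
    (E : Matrix (Fin d) (Fin d) ℝ) (hE : E = Matrix.diagonal (fun i => 1 / α i))
    (ν : Measure (Fin d → ℝ)) [IsProbabilityMeasure ν]
    (hν_nonneg : ∀ᵐ x ∂ν, ∀ i, 0 ≤ x i) (hν_full : IsFullMeasure ν)
    (μ : Measure (Fin d → ℤ)) [IsProbabilityMeasure μ]
    (hμ_pos : IsCarriedByPositive μ) (hμ_aper : IsAperiodic μ)
    (hμ_attr : InStrictDomainOfNormalAttraction E ν μ)
    {Ω : Type*} [MeasurableSpace Ω] (P : Measure Ω) [IsProbabilityMeasure P]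
    (Z : (Fin d → ℤ) → Ω → (Fin d → ℤ))
    (hZ_law : ∀ n, HasLaw (Z n) μ P) (hZ_indep : iIndepFun Z P) :
    (∀ᵐ ω ∂P, Infinite (digraphComponent (ancestorDigraph (fun n => Z n ω)))) ↔
      2 < E.trace := by
  subst hE
  have hconv := hμ_attr.scaledSumsConverge
  have hmeas : AEMeasurable (fun ω n => Z n ω) P :=
    aemeasurable_pi_lambda _ fun n => (hZ_law n).aemeasurable
  have hlaw := hZ_indep.hasLaw_infinitePi hZ_law hmeas
  -- Almost sure statements descend from the image law without measurability of `p`, so none is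
  -- needed for having infinitely many components.
  have htransfer : ∀ p : ((Fin d → ℤ) → (Fin d → ℤ)) → Prop,
      (∀ᵐ z ∂Measure.infinitePi (fun _ : Fin d → ℤ => μ), p z) →
        ∀ᵐ ω ∂P, p (fun n => Z n ω) := by
    intro p hp
    rw [← hlaw.map_eq] at hp
    exact ae_of_ae_map hmeas hp
  rw [Matrix.trace_diagonal]
  constructor
  · intro hinf
    by_contra hq
    obtain ⟨C, hC, htight⟩ := exists_half_le_measure hconv
    have hdiv := tsum_twoStepSequences_eq_top hμ_pos hα (not_lt.1 hq) hC htight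
    have hmeet := htransfer _ (ae_forall_linesMeet hd hμ_pos hμ_aper hdiv)
    obtain ⟨ω, h1, h2⟩ := (hinf.and hmeet).exists
    have : Subsingleton (digraphComponent (ancestorDigraph (fun n => Z n ω))) := by
      refine ⟨fun c c' => ?_⟩
      induction c using SimpleGraph.ConnectedComponent.ind with | _ x
      induction c' using SimpleGraph.ConnectedComponent.ind with | _ y
      exact SimpleGraph.ConnectedComponent.sound (reachable_iff_linesMeet.2 (h2 x y))
    exact not_finite (digraphComponent (ancestorDigraph (fun n => Z n ω)))
  · intro hq
    obtain ⟨b, hb, hdecay⟩ := exists_norm_stepChar_le hα hν_full hconv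
    obtain ⟨C, hC, hle⟩ := exists_sumMass_le hα hb hdecay
    exact htransfer _ (ae_infinite_digraphComponent hd hμ_pos
      (tendsto_tsum_twoStepSequences_diagVec hd hq hC hle))
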